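/- Let $m\ge 1$ be an integer, let $c\in(0,\infty)$, and put $y=1/m$. For positive integers $N_A,N_D$ let $X\in\mathcal H_A\otimes\mathcal H_B\otimes\mathcal H_C\otimes\mathcal H_D$, with $\dim\mathcal H_A=N_A$, $\dim\mathcal H_B=\dim\mathcal H_C=m$ and $\dim\mathcal H_D=N_D$, be a random tensor whose coordinates $X_{abcd}$ are independent standard complex Gaussian variables ($\mathbb E|X_{abcd}|^2=1$). Let $V_{AB}$ and $V_{AC}$ be the marginals $$(V_{AB})_{(a,b),(a',b')}=\sum_{c,d}X_{abcd}\overline{X_{a'b'cd}},\qquad (V_{AC})_{(a,c),(a',c')}=\sum_{b,d}X_{abcd}\overline{X_{a'bc'd}},$$ regarded as matrices on the same space by identifying $\mathcal H_B$ with $\mathcal H_C$, and let $P=V_{AB}^{1/2}V_{AC}V_{AB}^{1/2}$. Then $\operatorname{Tr}(P^n)$ is integrable for every $n\ge 0$, and there are real numbers $M_n$ ($n\ge0$), depending only on $m$ and $c$, such that, whenever $N_A\to\infty$ and $N_D=N_D(N_A)\sim c\,N_A$, $$\frac{\mathbb E(\operatorname{Tr}(P^n))}{(mN_A)^{2n+1}}\longrightarrow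 M_n\qquad(n\ge 0).$$ The limiting resolvent $W(z)=\sum_{n\ge0}M_nz^{-n-1}$ satisfies the equation $$\begin{aligned} &W^6\left(y^4z^4-2y^2z^4+z^4\right)+W^5\left(3cy^4z^3-6cy^2z^3+3cz^3-3y^4z^3+6y^2z^3-3z^3\right)\\ &+W^4\bigl(3c^2y^4z^2-6c^2y^2z^2+3c^2z^2-6cy^4z^2+12cy^2z^2-6cz^2+3y^4z^2-2y^2z^3-6y^2z^2-2z^3+3z^2\bigr)\\ &+W^3\bigl(c^3y^4z-2c^3y^2z+c^3z-3c^2y^4z+6c^2y^2z-3c^2z+3cy^4z-4cy^2z^2-6cy^2z-4cz^2+3cz\\ &\qquad\quad-y^4z+4y^2z^2+2y^2z+4z^2-z\bigr)\\ &+W^2\left(-2c^2y^2z-3c^2z+5cy^2z+5cz-3y^2z+z^2-2z\right)\\ &+W\left(-c^3+c^2y^2+2c^2-2cy^2+cz-c+y^2-z\right)-c=0 \end{aligned}$$ as a formal Laurent series in $1/z$. Moreover the series $W(z)$ converges absolutely for all complex $z$ of sufficiently large modulus, and the equation holds for its sum at every complex $z\ne0$ at which it converges absolutely. -/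

import Mathlib

open MeasureTheory ProbabilityTheory Filter Topology Asymptotics
open scoped NNReal MatrixOrder LaurentSeries PowerSeries

namespace RandomTensor

/-- Index set of the coordinates of a tensor in `H_A ⊗ H_B ⊗ H_C ⊗ H_D`, where
`dim H_A = NA`, `dim H_B = dim H_C = m` and `dim H_D = ND`. -/
abbrev Idx (NA m ND : ℕ) : Type := Fin NA × Fin m × Fin m × Fin ND

/-- Tensors in `H_A ⊗ H_B ⊗ H_C ⊗ H_D`, given by their complex coordinates `X (a, b, c, d)`. -/
abbrev Tensor (NA m ND : ℕ) : Type := Idx NA m ND → ℂ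

/-- The standard complex Gaussian law: independent centred real and imaginary parts of variance
`1 / 2`, so that the second absolute moment is `1`. -/
noncomputable def stdComplexGaussian : Measure ℂ :=
  ((gaussianReal 0 (1 / 2)).prod (gaussianReal 0 (1 / 2))).map
    (fun p : ℝ × ℝ => (⟨p.1, p.2⟩ : ℂ))

/-- The law of the random Gaussian tensor: its coordinates are independent standard complex
Gaussian variables. -/
noncomputable def gaussianTensor (NA m ND : ℕ) : Measure (Tensor NA m ND) :=
  Measure.pi fun _ => stdComplexGaussian

variable {NA m ND : ℕ}

/-- The marginal `V_AB`: the partial trace over `H_C ⊗ H_D` of `X ⊗ X^∨`, the latter being the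
operator with matrix entries `X i * conj (X j)`. -/
noncomputable def marginalAB (X : Tensor NA m ND) :
    Matrix (Fin NA × Fin m) (Fin NA × Fin m) ℂ :=
  Matrix.of fun p q => ∑ c : Fin m, ∑ d : Fin ND,
    X (p.1, p.2, c, d) * star (X (q.1, q.2, c, d))

/-- The marginal `V_AC`: the partial trace over `H_B ⊗ H_D` of `X ⊗ X^∨`. As `H_B` and `H_C` are
identified, it acts on the same space as `V_AB`. -/
noncomputable def marginalAC (X : Tensor NA m ND) :
    Matrix (Fin NA × Fin m) (Fin NA × Fin m) ℂ :=
  Matrix.of fun p q => ∑ b : Fin m, ∑ d : Fin ND,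
    X (p.1, b, p.2, d) * star (X (q.1, b, q.2, d))

/-- The product of marginals `P = V_AB^{1/2} V_AC V_AB^{1/2}`, where `V_AB^{1/2}` is the positive
semidefinite square root. -/
noncomputable def productOfMarginals (X : Tensor NA m ND) :
    Matrix (Fin NA × Fin m) (Fin NA × Fin m) ℂ :=
  CFC.sqrt (marginalAB X) * marginalAC X * CFC.sqrt (marginalAB X)

/-- The normalised moment `E(Tr(P^n)) / (m N_A)^{2n+1}`. -/
noncomputable def normalizedMoment (m NA ND n : ℕ) : ℂ :=
  (∫ X, (productOfMarginals X ^ n).trace ∂(gaussianTensor NA m ND)) /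
    ((m : ℂ) * (NA : ℂ)) ^ (2 * n + 1)

/-- The polynomial in `c`, `y`, `z` and `W`, of degree six in `W`, evaluated in a commutative
ring. -/
def resolventPolynomial {R : Type*} [CommRing R] (c y z W : R) : R :=
  W ^ 6 * (y ^ 4 * z ^ 4 - 2 * y ^ 2 * z ^ 4 + z ^ 4)
  + W ^ 5 * (3 * c * y ^ 4 * z ^ 3 - 6 * c * y ^ 2 * z ^ 3 + 3 * c * z ^ 3
      - 3 * y ^ 4 * z ^ 3 + 6 * y ^ 2 * z ^ 3 - 3 * z ^ 3)
  + W ^ 4 * (3 * c ^ 2 * y ^ 4 * z ^ 2 - 6 * c ^ 2 * y ^ 2 * z ^ 2 + 3 * c ^ 2 * z ^ 2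
      - 6 * c * y ^ 4 * z ^ 2 + 12 * c * y ^ 2 * z ^ 2 - 6 * c * z ^ 2
      + 3 * y ^ 4 * z ^ 2 - 2 * y ^ 2 * z ^ 3 - 6 * y ^ 2 * z ^ 2
      - 2 * z ^ 3 + 3 * z ^ 2)
  + W ^ 3 * (c ^ 3 * y ^ 4 * z - 2 * c ^ 3 * y ^ 2 * z + c ^ 3 * z
      - 3 * c ^ 2 * y ^ 4 * z + 6 * c ^ 2 * y ^ 2 * z - 3 * c ^ 2 * z
      + 3 * c * y ^ 4 * z - 4 * c * y ^ 2 * z ^ 2 - 6 * c * y ^ 2 * z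
      - 4 * c * z ^ 2 + 3 * c * z - y ^ 4 * z + 4 * y ^ 2 * z ^ 2
      + 2 * y ^ 2 * z + 4 * z ^ 2 - z)
  + W ^ 2 * (-2 * c ^ 2 * y ^ 2 * z - 3 * c ^ 2 * z + 5 * c * y ^ 2 * z
      + 5 * c * z - 3 * y ^ 2 * z + z ^ 2 - 2 * z)
  + W * (-c ^ 3 + c ^ 2 * y ^ 2 + 2 * c ^ 2 - 2 * c * y ^ 2 + c * z - c + y ^ 2 - z)
  - c

/-- The resolvent `W = ∑ n, M n * z ^ (-n-1)` with moments `M n`, as a formal Laurent series in the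
variable `1 / z`. -/
noncomputable def formalResolvent (M : ℕ → ℝ) : ℝ⸨X⸩ :=
  ((PowerSeries.X * PowerSeries.mk M : ℝ⟦X⟧) : ℝ⸨X⸩)

/-- The element `z` of the ring of formal Laurent series in the variable `1 / z`. -/
noncomputable def formalZ : ℝ⸨X⸩ := HahnSeries.single (-1) 1

/-- The `n`-th term `M n * z ^ (-n-1)` of the resolvent with moments `M n`, at a complex number
`z`. -/
noncomputable def resolventTerm (M : ℕ → ℝ) (z : ℂ) (n : ℕ) : ℂ := (M n : ℂ) * (z⁻¹) ^ (n + 1)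

end RandomTensor

/-! The trace of `P ^ n` equals that of `(V_AB V_AC) ^ n`. Write the tensor as an `m × m` array of
independent `N_A × N_D` Gaussian matrices `X_{bc}`. Then `V_AB = Y Yᴴ` and `V_AC = Z Zᴴ`, where the
block matrices `Y` and `Z` are made of the same blocks `X_{bc}` but with the roles of `b` and `c`
exchanged, so that the moment is a sum over block indices of expected traces of words in the
`X_{bc}` and their adjoints (`normalizedMoment_eq`).

Gaussian integration by parts (`gaussianExpect_X_mul`) applied to the first letter of such a word
gives the loop equation `gaussianExpect_traceProd_cons`: a contraction inside a trace splits it in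
two, a contraction between two traces joins them. With the normalisation `N_A ^ (traces + pairs)`
the first kind of term keeps its order and the second one loses a factor `N_A ^ 2`. Induction on the
number of letters and traces therefore shows that expectations of products of traces converge and
factorise in the limit (`tendsto_traceProd`), the limit of a single word being the sum
`limitTrace` over noncrossing pairings.

Summing over the block indices, the limits of the partial traces become multiples of the identity
matrix (`pathSum_limitTrace`): in the cyclic product `Y Yᴴ Z Zᴴ ⋯` a factor that is paired with its
own adjoint produces a free index and hence a factor `m`, while a pairing of `Y` with `Zᴴ` or of
`Yᴴ` with `Z` produces none. The resulting scalars satisfy a Catalan-like quadratic recursion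
(`limitMoment_succ`). Its parity-dependent weights lead to four quadratic equations for the even and
odd parts of two generating series, and eliminating three of the four series gives the equation of
degree six (`reducedPolynomial_eq_zero`), here in the variables `u = 1 / z` and `E = z W`.

Comparison with the Catalan numbers bounds the moments exponentially, and evaluation at a point of
absolute convergence is a ring homomorphism (`evalSeries`), which carries the formal equation over
to the sum of the series. -/

namespace RandomTensor

/-! ### Moments of complex Gaussian variables and integration by parts -/

instance : IsProbabilityMeasure stdComplexGaussian := by
  unfold stdComplexGaussian
  exact Measure.isProbabilityMeasure_map (by
    exact Complex.measurableEquivRealProd.symm.measurable.aemeasurable)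

/-- The standard complex Gaussian law has density `π⁻¹ exp (-‖z‖ ^ 2)`. -/
theorem integral_stdComplexGaussian (f : ℂ → ℂ) :
    ∫ z, f z ∂stdComplexGaussian
      = ∫ z : ℂ, ((Real.pi⁻¹ * Real.exp (-‖z‖ ^ 2) : ℝ) : ℂ) * f z := by
  have hmap : stdComplexGaussian = ((gaussianReal 0 (1 / 2)).prod (gaussianReal 0 (1 / 2))).map
    Complex.measurableEquivRealProd.symm := rfl
  have hdens : (gaussianReal 0 (1 / 2)).prod (gaussianReal 0 (1 / 2))
      = (volume : Measure (ℝ × ℝ)).withDensity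
        (fun p => gaussianPDF 0 (1 / 2) p.1 * gaussianPDF 0 (1 / 2) p.2) := by
    rw [gaussianReal_of_var_ne_zero _ (by norm_num),
      prod_withDensity (measurable_gaussianPDF _ _) (measurable_gaussianPDF _ _)]
    rfl
  rw [hmap, integral_map_equiv, hdens, integral_withDensity_eq_integral_toReal_smul
    (show Measurable fun p : ℝ × ℝ => gaussianPDF 0 (1 / 2) p.1 * gaussianPDF 0 (1 / 2) p.2 from
      ((measurable_gaussianPDF _ _).comp measurable_fst).mul
        ((measurable_gaussianPDF _ _).comp measurable_snd))]
  · rw [← (Complex.volume_preserving_equiv_real_prod.symm).integral_comp'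
      (g := fun z : ℂ => ((Real.pi⁻¹ * Real.exp (-‖z‖ ^ 2) : ℝ) : ℂ) * f z)]
    congr 1
    ext p
    have h1 : (gaussianPDF 0 (1 / 2) p.1 * gaussianPDF 0 (1 / 2) p.2).toReal
        = Real.pi⁻¹ * Real.exp (-‖Complex.measurableEquivRealProd.symm p‖ ^ 2) := by
      have hn : ‖Complex.measurableEquivRealProd.symm p‖ ^ 2 = p.1 ^ 2 + p.2 ^ 2 := by
        rw [Complex.sq_norm, Complex.normSq_apply]
        simp [pow_two]
      rw [hn, ENNReal.toReal_mul, toReal_gaussianPDF, toReal_gaussianPDF]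
      simp only [gaussianPDFReal]
      have h2 : (2 * Real.pi * ((1 / 2 : ℝ≥0) : ℝ)) = Real.pi := by
        push_cast; ring
      have h3 : (2 * ((1 / 2 : ℝ≥0) : ℝ)) = 1 := by
        push_cast; ring
      rw [h2, h3, mul_mul_mul_comm, ← mul_inv, Real.mul_self_sqrt Real.pi_pos.le, ← Real.exp_add]
      congr 2
      ring
    rw [h1, Complex.real_smul]
  · refine ae_of_all _ fun p => ?_
    exact ENNReal.mul_lt_top ENNReal.ofReal_lt_top ENNReal.ofReal_lt_top

/-- The mixed moments of the standard complex Gaussian law. -/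
theorem integral_pow_mul_conj_pow (a b : ℕ) :
    ∫ z, z ^ a * star z ^ b ∂stdComplexGaussian = if a = b then (a.factorial : ℂ) else 0 := by
  rw [integral_stdComplexGaussian]
  split_ifs with hab
  · subst hab
    have h := Complex.integral_rpow_mul_exp_neg_rpow (p := 2) (q := 2 * a) (by norm_num)
      (by have : (0 : ℝ) ≤ a := a.cast_nonneg
          linarith)
    have h1 : ∀ z : ℂ, ((Real.pi⁻¹ * Real.exp (-‖z‖ ^ 2) : ℝ) : ℂ) * (z ^ a * star z ^ a)
        = ((Real.pi⁻¹ * (‖z‖ ^ (2 * a : ℝ) * Real.exp (-‖z‖ ^ (2 : ℝ))) : ℝ) : ℂ) := by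
      intro z
      have h2 : z ^ a * star z ^ a = ((‖z‖ ^ (2 * a) : ℝ) : ℂ) := by
        rw [← mul_pow, pow_mul, Complex.star_def, Complex.mul_conj, Complex.normSq_eq_norm_sq]
        push_cast; rfl
      have h3 : ‖z‖ ^ (2 * a : ℝ) = ‖z‖ ^ (2 * a) := by
        rw [← Real.rpow_natCast]; push_cast; rfl
      rw [h2, h3, Real.rpow_two, ← Complex.ofReal_mul]
      congr 1; ring
    simp_rw [h1]
    rw [integral_complex_ofReal, integral_const_mul, h]
    have : ((2 * a + 2) / 2 : ℝ) = a + 1 := by ring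
    rw [this, Real.Gamma_nat_eq_factorial]
    push_cast
    field_simp
  · -- rotating by a phase `ω` with `ω ^ (a - b) = -1` changes the sign of the integral
    set θ : ℝ := Real.pi / ((a : ℝ) - b) with hθ
    have hne : ((a : ℝ) - b) ≠ 0 := sub_ne_zero.mpr (by exact_mod_cast hab)
    set g : ℂ → ℂ := fun z => ((Real.pi⁻¹ * Real.exp (-‖z‖ ^ 2) : ℝ) : ℂ) * (z ^ a * star z ^ b)
    have hrot := (rotation (Circle.exp θ)).measurePreserving.integral_comp
      (rotation (Circle.exp θ)).toHomeomorph.measurableEmbedding g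
    have hg : ∀ z, g (rotation (Circle.exp θ) z) = - g z := by
      intro z
      have hω : (Circle.exp θ : ℂ) ^ a * star (Circle.exp θ : ℂ) ^ b = -1 := by
        rw [Circle.coe_exp, Complex.star_def, ← Complex.exp_conj, ← Complex.exp_nat_mul,
          ← Complex.exp_nat_mul, ← Complex.exp_add, ← Complex.exp_pi_mul_I]
        congr 1
        rw [map_mul, Complex.conj_I, Complex.conj_ofReal]
        have : (Real.pi : ℂ) = θ * (a - b) := by
          rw [hθ]; push_cast
          have : (a : ℂ) - b ≠ 0 := by exact_mod_cast hne
          field_simp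
        rw [this]; ring
      simp only [g, rotation_apply, star_mul', mul_pow, norm_mul, Circle.norm_coe, one_mul]
      linear_combination ((Real.pi⁻¹ * Real.exp (-‖z‖ ^ 2) : ℝ) : ℂ) * (z ^ a * star z ^ b) * hω
    simp_rw [hg] at hrot
    rw [integral_neg] at hrot
    exact self_eq_neg.mp hrot.symm

theorem memLp_stdComplexGaussian (p : ℝ≥0) :
    MemLp (id : ℂ → ℂ) p stdComplexGaussian := by
  have hmap : stdComplexGaussian = ((gaussianReal 0 (1 / 2)).prod (gaussianReal 0 (1 / 2))).map
    Complex.measurableEquivRealProd.symm := rfl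
  rw [hmap, memLp_map_measure_iff (by fun_prop) (by fun_prop)]
  have h1 : MemLp (fun q : ℝ × ℝ => q.1) p
      ((gaussianReal 0 (1 / 2)).prod (gaussianReal 0 (1 / 2))) :=
    (memLp_id_gaussianReal p).comp_fst _
  have h2 : MemLp (fun q : ℝ × ℝ => q.2) p
      ((gaussianReal 0 (1 / 2)).prod (gaussianReal 0 (1 / 2))) :=
    (memLp_id_gaussianReal p).comp_snd _
  have h := h1.ofReal (K := ℂ) |>.add ((h2.ofReal (K := ℂ)).mul_const Complex.I)
  refine (memLp_congr_ae (ae_of_all _ fun q => ?_)).mp h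
  simp [Complex.measurableEquivRealProd, Complex.ext_iff]

theorem integrable_pow_mul_conj_pow (a b : ℕ) :
    Integrable (fun z : ℂ => z ^ a * star z ^ b) stdComplexGaussian := by
  have h := (memLp_stdComplexGaussian ((a + b : ℕ) : ℝ≥0)).integrable_norm_pow' (p := a + b)
  refine h.mono (by fun_prop) (ae_of_all _ fun z => ?_)
  simp [pow_add]

/-- The value at `X : α → ℂ` of the variables `(i, false)`, standing for `X i`, and `(i, true)`,
standing for the complex conjugate of `X i`. -/
noncomputable def conjPairEval {α : Type*} (X : α → ℂ) : MvPolynomial (α × Bool) ℂ →ₐ[ℂ] ℂ :=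
  MvPolynomial.aeval fun v => bif v.2 then star (X v.1) else X v.1

section Expectation

variable {α : Type*} [Fintype α]

theorem conjPairEval_monomial (X : α → ℂ) (e : α × Bool →₀ ℕ) (r : ℂ) :
    conjPairEval X (MvPolynomial.monomial e r)
      = r * ∏ i, (X i ^ e (i, false) * star (X i) ^ e (i, true)) := by
  rw [conjPairEval, MvPolynomial.aeval_monomial, Finsupp.prod_fintype _ _ (by simp),
    Fintype.prod_prod_type]
  simp [mul_comm]

theorem integrable_conjPairEval (f : MvPolynomial (α × Bool) ℂ) :
    Integrable (fun X => conjPairEval X f) (Measure.pi fun _ : α => stdComplexGaussian) := by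
  induction f using MvPolynomial.induction_on' with
  | monomial e r =>
    simp_rw [conjPairEval_monomial]
    exact (Integrable.fintype_prod (f := fun i z => z ^ e (i, false) * star z ^ e (i, true))
      fun i => integrable_pow_mul_conj_pow _ _).const_mul r
  | add p q hp hq =>
    simp_rw [map_add]
    exact hp.add hq

/-- Expectation of a polynomial in independent standard complex Gaussian variables and their
conjugates. -/
noncomputable def gaussianExpect : MvPolynomial (α × Bool) ℂ →ₗ[ℂ] ℂ where
  toFun f := ∫ X, conjPairEval X f ∂(Measure.pi fun _ : α => stdComplexGaussian)
  map_add' f g := by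
    simp_rw [map_add]
    exact integral_add (integrable_conjPairEval f) (integrable_conjPairEval g)
  map_smul' r f := by
    simp_rw [map_smul]
    exact integral_smul r _

theorem gaussianExpect_one : gaussianExpect (1 : MvPolynomial (α × Bool) ℂ) = 1 := by
  simp [gaussianExpect]

theorem gaussianExpect_monomial (e : α × Bool →₀ ℕ) (r : ℂ) :
    gaussianExpect (MvPolynomial.monomial e r)
      = r * ∏ i, (if e (i, false) = e (i, true) then ((e (i, false)).factorial : ℂ) else 0) := by
  change ∫ X, conjPairEval X _ ∂_ = _
  simp_rw [conjPairEval_monomial]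
  rw [integral_const_mul,
    integral_fintype_prod_eq_prod (f := fun i z => z ^ e (i, false) * star z ^ e (i, true))]
  simp_rw [integral_pow_mul_conj_pow]

/-- Gaussian integration by parts: a Gaussian variable acts inside the expectation as the
derivative with respect to its conjugate. -/
theorem gaussianExpect_X_mul [DecidableEq α] (i : α) (s : Bool) (f : MvPolynomial (α × Bool) ℂ) :
    gaussianExpect (MvPolynomial.X (i, s) * f)
      = gaussianExpect (MvPolynomial.pderiv (i, !s) f) := by
  induction f using MvPolynomial.induction_on' with
  | add p q hp hq => rw [mul_add, map_add, map_add, map_add, hp, hq]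
  | monomial e r =>
    rw [MvPolynomial.pderiv_monomial, MvPolynomial.X, MvPolynomial.monomial_mul, one_mul,
      gaussianExpect_monomial, gaussianExpect_monomial,
      ← Finset.mul_prod_erase _ _ (Finset.mem_univ i),
      ← Finset.mul_prod_erase _ _ (Finset.mem_univ i), mul_assoc, ← mul_assoc (e (i, !s) : ℂ)]
    congr 2
    · cases s <;> simp
      · rcases h : e (i, true) with _ | k
        · simp
        · by_cases hk : e (i, false) = k
          · simp [hk, add_comm 1 k, Nat.factorial_succ]
          · simp [hk, add_comm 1]
      · rcases h : e (i, false) with _ | k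
        · simp; omega
        · by_cases hk : e (i, true) = k
          · simp [hk, add_comm 1 k, Nat.factorial_succ]
          · have : k ≠ e (i, true) := fun h => hk h.symm
            simp [this, add_comm 1]
    · refine Finset.prod_congr rfl fun j hj => ?_
      have hji : i ≠ j := (Finset.ne_of_mem_erase hj).symm
      simp [hji]

end Expectation

/-! ### Words in Gaussian matrices and the loop equation -/

/-- The sum of `f v l w` over all the ways `u = v ++ l :: w` of singling out an entry of `u`. -/
def splitSum {β M : Type*} [AddCommMonoid M] : List β → (List β → β → List β → M) → M
  | [], _ => 0
  | l :: u, f => f [] l u + splitSum u fun v l' w => f (l :: v) l' w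

section SplitSum

variable {β M N : Type*} [AddCommMonoid M] [AddCommMonoid N]

theorem splitSum_congr {u : List β} {f g : List β → β → List β → M}
    (h : ∀ v l w, u = v ++ l :: w → f v l w = g v l w) : splitSum u f = splitSum u g := by
  induction u generalizing f g with
  | nil => rfl
  | cons l u ih =>
    simp only [splitSum]
    rw [h [] l u rfl, ih fun v l' w e => h (l :: v) l' w (by rw [e]; rfl)]

theorem map_splitSum (φ : M →+ N) (u : List β) (f : List β → β → List β → M) :
    φ (splitSum u f) = splitSum u fun v l w => φ (f v l w) := by
  induction u generalizing f with
  | nil => exact map_zero φ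
  | cons l u ih => simp only [splitSum, map_add, ih]

theorem mul_splitSum {R : Type*} [NonUnitalNonAssocSemiring R] (r : R) (u : List β)
    (f : List β → β → List β → R) :
    r * splitSum u f = splitSum u fun v l w => r * f v l w :=
  map_splitSum (AddMonoidHom.mulLeft r) u f

theorem splitSum_mul {R : Type*} [NonUnitalNonAssocSemiring R] (r : R) (u : List β)
    (f : List β → β → List β → R) :
    splitSum u f * r = splitSum u fun v l w => f v l w * r :=
  map_splitSum (AddMonoidHom.mulRight r) u f

theorem splitSum_finsetSum {κ : Type*} (S : Finset κ) (u : List β)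
    (f : κ → List β → β → List β → M) :
    ∑ k ∈ S, splitSum u (f k) = splitSum u fun v l w => ∑ k ∈ S, f k v l w := by
  induction u generalizing f with
  | nil => simp [splitSum]
  | cons l u ih => simp only [splitSum, Finset.sum_add_distrib, ih]

theorem tendsto_splitSum [TopologicalSpace M] [ContinuousAdd M] {κ : Type*} {F : Filter κ}
    {u : List β} {f : κ → List β → β → List β → M} {g : List β → β → List β → M}
    (h : ∀ v l w, u = v ++ l :: w → Tendsto (fun k => f k v l w) F (𝓝 (g v l w))) :
    Tendsto (fun k => splitSum u (f k)) F (𝓝 (splitSum u g)) := by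
  induction u generalizing f g with
  | nil => exact tendsto_const_nhds
  | cons l u ih =>
    exact (h [] l u rfl).add (ih fun v l' w e => h (l :: v) l' w (by rw [e]; rfl))

theorem splitSum_zero (u : List β) : splitSum u (fun _ _ _ => (0 : M)) = 0 := by
  induction u with
  | nil => rfl
  | cons l u ih => simp [splitSum, ih]

theorem tendsto_splitSum_zero [TopologicalSpace M] [ContinuousAdd M] {κ : Type*} {F : Filter κ}
    {u : List β} {f : κ → List β → β → List β → M}
    (h : ∀ v l w, u = v ++ l :: w → Tendsto (fun k => f k v l w) F (𝓝 0)) :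
    Tendsto (fun k => splitSum u (f k)) F (𝓝 0) := by
  rw [← splitSum_zero (M := M) u]
  exact tendsto_splitSum h

/-- The Leibniz rule for the product of a list. -/
theorem derivation_list_prod {R : Type*} [CommRing R] [Algebra ℂ R]
    (D : Derivation ℂ R R) (g : β → R) (u : List β) :
    D (u.map g).prod
      = splitSum u fun v l w => (v.map g).prod * D (g l) * (w.map g).prod := by
  induction u with
  | nil => simp [splitSum]
  | cons l u ih =>
    rw [List.map_cons, List.prod_cons, Derivation.leibniz, ih]
    simp only [splitSum, smul_eq_mul, mul_splitSum, List.map_nil, List.prod_nil, one_mul,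
      List.map_cons, List.prod_cons]
    rw [add_comm, mul_comm (D (g l))]
    congr 1
    exact splitSum_congr fun _ _ _ _ => by ring

end SplitSum

/-- Letters: `(i, false)` stands for the block `X_i` and `(i, true)` for its adjoint, where `X_i`,
`i = (b, c)`, is the `N_A × N_D` matrix of the coordinates `X (a, b, c, d)`. -/
abbrev Letter (m : ℕ) : Type := (Fin m × Fin m) × Bool

/-- The ring of polynomials in the coordinates of a tensor and their complex conjugates. -/
abbrev CoordRing (NA m ND : ℕ) : Type := MvPolynomial (Idx NA m ND × Bool) ℂ

section Words

variable {NA m ND : ℕ}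

/-- The letters as matrices on the direct sum of `H_A` and `H_D`. -/
noncomputable def letterMat (x : Letter m) :
    Matrix (Fin NA ⊕ Fin ND) (Fin NA ⊕ Fin ND) (CoordRing NA m ND) :=
  match x with
  | (i, false) => Matrix.of fun k l => match k, l with
    | .inl a, .inr d => MvPolynomial.X ((a, i.1, i.2, d), false)
    | _, _ => 0
  | (i, true) => Matrix.of fun k l => match k, l with
    | .inr d, .inl a => MvPolynomial.X ((a, i.1, i.2, d), true)
    | _, _ => 0

/-- The derivative with respect to the `(l, k)` entry of the adjoint letter of `(i, s)`: inside
Gaussian expectations it replaces the `(k, l)` entry of the letter `(i, s)`. -/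
noncomputable def letterDeriv (i : Fin m × Fin m) (s : Bool) (k l : Fin NA ⊕ Fin ND) :
    Derivation ℂ (CoordRing NA m ND) (CoordRing NA m ND) :=
  match s, k, l with
  | false, .inl a, .inr d => MvPolynomial.pderiv ((a, i.1, i.2, d), true)
  | true, .inr d, .inl a => MvPolynomial.pderiv ((a, i.1, i.2, d), false)
  | _, _, _ => 0

theorem gaussianExpect_letterMat_mul (i : Fin m × Fin m) (s : Bool) (k l : Fin NA ⊕ Fin ND)
    (f : CoordRing NA m ND) :
    gaussianExpect (letterMat (i, s) k l * f) = gaussianExpect (letterDeriv i s k l f) := by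
  rcases s with _ | _ <;> rcases k with a | d <;> rcases l with a' | d' <;>
    simp [letterMat, letterDeriv, gaussianExpect_X_mul]

theorem letterDeriv_letterMat (i : Fin m × Fin m) (s : Bool) (k l k' l' : Fin NA ⊕ Fin ND)
    (x : Letter m) :
    letterDeriv i s k l (letterMat x k' l')
      = if x = (i, !s) then
          (if k.isRight = s ∧ l.isRight = !s then (if k' = l ∧ l' = k then 1 else 0) else 0)
        else 0 := by
  obtain ⟨⟨b, c⟩, t⟩ := x
  obtain ⟨b', c'⟩ := i
  rcases s with _ | _ <;> rcases t with _ | _ <;> rcases k with a | d <;> rcases l with a' | d' <;>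
    rcases k' with a₁ | d₁ <;> rcases l' with a₂ | d₂ <;>
    simp [letterMat, letterDeriv, MvPolynomial.pderiv_X, Pi.single_apply] <;> grind

theorem letterMat_eq_zero (x : Letter m) (k l : Fin NA ⊕ Fin ND)
    (h : ¬ (k.isRight = x.2 ∧ l.isRight = !x.2)) :
    (letterMat x k l : CoordRing NA m ND) = 0 := by
  obtain ⟨i, t⟩ := x
  rcases t with _ | _ <;> rcases k with a | d <;> rcases l with a' | d' <;>
    simp_all [letterMat]

/-- The product of the letters of a word. -/
noncomputable def wordMat (u : List (Letter m)) :
    Matrix (Fin NA ⊕ Fin ND) (Fin NA ⊕ Fin ND) (CoordRing NA m ND) :=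
  (u.map letterMat).prod

theorem wordMat_cons (x : Letter m) (u : List (Letter m)) :
    (wordMat (x :: u) : Matrix (Fin NA ⊕ Fin ND) _ (CoordRing NA m ND))
      = letterMat x * wordMat u := by
  simp [wordMat]

theorem wordMat_append (u v : List (Letter m)) :
    (wordMat (u ++ v) : Matrix (Fin NA ⊕ Fin ND) _ (CoordRing NA m ND))
      = wordMat u * wordMat v := by
  simp [wordMat]

/-- Every letter exchanges `H_A` and `H_D`. -/
theorem wordMat_eq_zero (u : List (Letter m)) (k l : Fin NA ⊕ Fin ND)
    (h : l.isRight ≠ (k.isRight ^^ u.length.bodd)) :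
    (wordMat u k l : CoordRing NA m ND) = 0 := by
  induction u generalizing k with
  | nil =>
    rw [wordMat, List.map_nil, List.prod_nil, Matrix.one_apply_ne]
    rintro rfl
    simp at h
  | cons x u ih =>
    rw [wordMat_cons, Matrix.mul_apply]
    refine Finset.sum_eq_zero fun j _ => ?_
    by_cases hj : k.isRight = x.2 ∧ j.isRight = !x.2
    · rw [ih j, mul_zero]
      rw [hj.2, ← hj.1]
      rw [List.length_cons, Nat.bodd_succ] at h
      revert h
      cases l.isRight <;> cases k.isRight <;> cases u.length.bodd <;> simp
    · rw [letterMat_eq_zero x k j hj, zero_mul]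

theorem letterDeriv_wordMat (i : Fin m × Fin m) (s : Bool) (k l k' l' : Fin NA ⊕ Fin ND)
    (hk : k.isRight = s) (hl : l.isRight = !s) (u : List (Letter m)) :
    letterDeriv i s k l (wordMat u k' l')
      = splitSum u fun v x w => if x = (i, !s) then wordMat v k' l * wordMat w k l' else 0 := by
  induction u generalizing k' with
  | nil =>
    rw [wordMat, List.map_nil, List.prod_nil, Matrix.one_apply, splitSum]
    split_ifs <;> simp
  | cons x u ih =>
    rw [wordMat_cons, Matrix.mul_apply, map_sum]
    simp_rw [Derivation.leibniz, ih, smul_eq_mul, letterDeriv_letterMat, hk, hl]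
    rw [Finset.sum_add_distrib, add_comm]
    simp only [splitSum]
    congr 1
    · by_cases hx : x = (i, !s)
      · simp only [hx, if_true, and_self, mul_ite, mul_one, mul_zero]
        simp only [wordMat, List.map_nil, List.prod_nil, Matrix.one_apply]
        by_cases hkl : k' = l
        · simp [hkl]
        · simp [hkl]
      · simp [hx]
    · simp_rw [mul_splitSum]
      rw [splitSum_finsetSum]
      refine splitSum_congr fun v y w _ => ?_
      split_ifs
      · rw [wordMat_cons, Matrix.mul_apply, Finset.sum_mul]
        simp_rw [mul_assoc]
      · simp

/-- The trace of a word over `H_A` (for `s = false`) or over `H_D` (for `s = true`). -/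
noncomputable def wordTrace (NA ND : ℕ) (s : Bool) (u : List (Letter m)) : CoordRing NA m ND :=
  ∑ k : Fin NA ⊕ Fin ND, if k.isRight = s then wordMat u k k else 0

theorem wordTrace_nil (s : Bool) :
    wordTrace NA ND s ([] : List (Letter m))
      = ((bif s then ND else NA : ℕ) : CoordRing NA m ND) := by
  simp only [wordTrace, wordMat, List.map_nil, List.prod_nil, Matrix.one_apply_eq,
    Fintype.sum_sum_type]
  cases s <;> simp

theorem wordTrace_cons_of_ne {s : Bool} {x : Letter m} (h : x.2 ≠ s) (u : List (Letter m)) :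
    wordTrace NA ND s (x :: u) = 0 := by
  refine Finset.sum_eq_zero fun k _ => ?_
  split_ifs with hk
  · rw [wordMat_cons, Matrix.mul_apply]
    refine Finset.sum_eq_zero fun j _ => ?_
    rw [letterMat_eq_zero x k j fun hx => h (by rw [← hx.1, hk]), zero_mul]
  · rfl

/-- The product of the traces of a list of words. -/
noncomputable def traceProd (NA ND : ℕ) (W : List (Bool × List (Letter m))) : CoordRing NA m ND :=
  (W.map fun p => wordTrace NA ND p.1 p.2).prod

theorem traceProd_cons (p : Bool × List (Letter m)) (W : List (Bool × List (Letter m))) :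
    traceProd NA ND (p :: W) = wordTrace NA ND p.1 p.2 * traceProd NA ND W := by
  simp [traceProd]

theorem letterDeriv_wordTrace (i : Fin m × Fin m) (s t : Bool) (k l : Fin NA ⊕ Fin ND)
    (hk : k.isRight = s) (hl : l.isRight = !s) (u : List (Letter m)) :
    letterDeriv i s k l (wordTrace NA ND t u)
      = splitSum u fun v x w => if x = (i, !s) then
          ∑ j : Fin NA ⊕ Fin ND, (if j.isRight = t then wordMat v j l * wordMat w k j else 0)
        else 0 := by
  rw [wordTrace, map_sum]
  have : ∀ j : Fin NA ⊕ Fin ND,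
      letterDeriv i s k l (if j.isRight = t then wordMat u j j else 0)
        = splitSum u fun v x w => if x = (i, !s) then
          (if j.isRight = t then wordMat v j l * wordMat w k j else 0) else 0 := by
    intro j
    split_ifs with hj
    · exact letterDeriv_wordMat i s k l j j hk hl u
    · simp [splitSum_zero]
  simp_rw [this]
  rw [splitSum_finsetSum]
  refine splitSum_congr fun v x w _ => ?_
  split_ifs <;> simp

/-- Replacing a letter of a trace by the word `u`, with the two ends of `u` restricted to the
summands to which the neighbouring letters belong, gives the trace of the new word or zero. -/
theorem sum_wordMat_mul_eq (s t : Bool) (u v w : List (Letter m)) :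
    (∑ k : Fin NA ⊕ Fin ND, ∑ l : Fin NA ⊕ Fin ND,
      if k.isRight = s ∧ l.isRight = !s then
        (wordMat u l k : CoordRing NA m ND) *
          ∑ j : Fin NA ⊕ Fin ND, (if j.isRight = t then wordMat v j l * wordMat w k j else 0)
      else 0)
      = if (t ^^ v.length.bodd) = !s ∧ (!s ^^ u.length.bodd) = s then
          wordTrace NA ND t (v ++ (u ++ w)) else 0 := by
  have key : ∀ k l j : Fin NA ⊕ Fin ND, j.isRight = t →
      (if k.isRight = s ∧ l.isRight = !s then
        (wordMat v j l * (wordMat u l k * wordMat w k j) : CoordRing NA m ND) else 0)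
      = if (t ^^ v.length.bodd) = !s ∧ (!s ^^ u.length.bodd) = s then
          wordMat v j l * (wordMat u l k * wordMat w k j) else 0 := by
    intro k l j hj
    by_cases h1 : l.isRight = (j.isRight ^^ v.length.bodd)
    · by_cases h2 : k.isRight = (l.isRight ^^ u.length.bodd)
      · rw [hj] at h1
        congr 1
        rw [h2, h1]
        grind
      · rw [wordMat_eq_zero u l k h2]; simp
    · rw [wordMat_eq_zero v j l h1]; simp
  have step : ∀ k l : Fin NA ⊕ Fin ND, (if k.isRight = s ∧ l.isRight = !s then
        (wordMat u l k : CoordRing NA m ND) *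
          ∑ j : Fin NA ⊕ Fin ND, (if j.isRight = t then wordMat v j l * wordMat w k j else 0)
      else 0) = ∑ j : Fin NA ⊕ Fin ND, if j.isRight = t then
        (if (t ^^ v.length.bodd) = !s ∧ (!s ^^ u.length.bodd) = s then
          wordMat v j l * (wordMat u l k * wordMat w k j) else 0) else 0 := by
    intro k l
    have : ∀ j : Fin NA ⊕ Fin ND, (if j.isRight = t then
        (if (t ^^ v.length.bodd) = !s ∧ (!s ^^ u.length.bodd) = s then
          (wordMat v j l * (wordMat u l k * wordMat w k j) : CoordRing NA m ND) else 0) else 0)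
        = if k.isRight = s ∧ l.isRight = !s then
          wordMat u l k * (if j.isRight = t then wordMat v j l * wordMat w k j else 0) else 0 := by
      intro j
      by_cases hj : j.isRight = t
      · rw [if_pos hj, if_pos hj, ← key k l j hj]
        split_ifs
        · ring
        · rfl
      · simp [hj]
    simp_rw [this]
    rw [Finset.mul_sum]
    split_ifs <;> simp
  simp_rw [step]
  rw [Finset.sum_comm, Finset.sum_congr rfl fun l _ => Finset.sum_comm, Finset.sum_comm]
  split_ifs
  · refine Finset.sum_congr rfl fun j _ => ?_
    split_ifs
    · simp_rw [wordMat_append, Matrix.mul_apply, Finset.mul_sum]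
    · simp
  · simp

/-- Contracting the first letter of the word `(i, s) :: u` with the remaining letters of its trace
splits the trace in two; contracting it with a letter of another trace joins the two traces. -/
theorem sum_letterDeriv_eq (i : Fin m × Fin m) (s : Bool) (u : List (Letter m))
    (W : List (Bool × List (Letter m))) :
    (∑ k : Fin NA ⊕ Fin ND, ∑ l : Fin NA ⊕ Fin ND, if k.isRight = s ∧ l.isRight = !s then
      letterDeriv i s k l (wordMat u l k * traceProd NA ND W) else 0)
    = (splitSum u fun v x w =>
        if x = (i, !s) then traceProd NA ND ((!s, v) :: (s, w) :: W) else 0)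
      + splitSum W fun W₁ p W₂ => splitSum p.2 fun v x w =>
        if x = (i, !s) then
          (if (p.1 ^^ v.length.bodd) = !s ∧ (!s ^^ u.length.bodd) = s then
            traceProd NA ND (W₁ ++ (p.1, v ++ (u ++ w)) :: W₂) else 0) else 0 := by
  have expand : ∀ k l : Fin NA ⊕ Fin ND, (if k.isRight = s ∧ l.isRight = !s then
      letterDeriv i s k l (wordMat u l k * traceProd NA ND W) else 0)
      = (splitSum u fun v x w => if x = (i, !s) then
          (if k.isRight = s ∧ l.isRight = !s then
            wordMat v l l * wordMat w k k * traceProd NA ND W else 0) else 0)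
        + splitSum W fun W₁ p W₂ => splitSum p.2 fun v x w => if x = (i, !s) then
          traceProd NA ND W₁ * (if k.isRight = s ∧ l.isRight = !s then wordMat u l k *
            ∑ j : Fin NA ⊕ Fin ND, (if j.isRight = p.1 then wordMat v j l * wordMat w k j else 0)
            else 0) * traceProd NA ND W₂ else 0 := by
    intro k l
    split_ifs with h
    · rw [Derivation.leibniz, add_comm, smul_eq_mul, smul_eq_mul,
        letterDeriv_wordMat i s k l l k h.1 h.2, traceProd, derivation_list_prod, mul_splitSum,
        mul_splitSum]
      congr 1
      · refine splitSum_congr fun v x w _ => ?_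
        split_ifs
        · ring
        · simp
      · refine splitSum_congr fun W₁ p W₂ _ => ?_
        rw [letterDeriv_wordTrace i s p.1 k l h.1 h.2, mul_splitSum, splitSum_mul, mul_splitSum]
        refine splitSum_congr fun v x w _ => ?_
        split_ifs
        · simp only [traceProd]
          ring
        · simp
    · simp [splitSum_zero]
  simp_rw [expand, Finset.sum_add_distrib, splitSum_finsetSum]
  congr 1
  · refine splitSum_congr fun v x w _ => ?_
    split_ifs
    · rw [traceProd_cons, traceProd_cons, ← mul_assoc, wordTrace, wordTrace, Finset.sum_mul_sum,
        Finset.sum_comm, Finset.sum_mul]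
      refine Finset.sum_congr rfl fun k _ => ?_
      rw [Finset.sum_mul]
      refine Finset.sum_congr rfl fun l _ => ?_
      by_cases hk : k.isRight = !s <;> by_cases hl : l.isRight = s <;> simp [hk, hl]
    · simp
  · refine splitSum_congr fun W₁ p W₂ _ => splitSum_congr fun v x w _ => ?_
    split_ifs with hx hc
    · simp_rw [← Finset.sum_mul, ← Finset.mul_sum]
      rw [sum_wordMat_mul_eq, if_pos hc]
      simp [traceProd, mul_assoc]
    · simp_rw [← Finset.sum_mul, ← Finset.mul_sum]
      rw [sum_wordMat_mul_eq, if_neg hc]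
      simp
    · simp

/-- The loop (Schwinger–Dyson) equation for expectations of products of traces: Gaussian
integration by parts on the first letter of the first word. The parity condition says that the
ends of `u` fit the place left by the contracted letter of the other word. -/
theorem gaussianExpect_traceProd_cons (i : Fin m × Fin m) (s : Bool) (u : List (Letter m))
    (W : List (Bool × List (Letter m))) :
    gaussianExpect (traceProd NA ND ((s, (i, s) :: u) :: W))
    = (splitSum u fun v x w => if x = (i, !s) then
          gaussianExpect (traceProd NA ND ((!s, v) :: (s, w) :: W)) else 0)
      + splitSum W fun W₁ p W₂ => splitSum p.2 fun v x w => if x = (i, !s) then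
          (if (p.1 ^^ v.length.bodd) = !s ∧ (!s ^^ u.length.bodd) = s then
            gaussianExpect (traceProd NA ND (W₁ ++ (p.1, v ++ (u ++ w)) :: W₂)) else 0) else 0 := by
  have h1 : traceProd NA ND ((s, (i, s) :: u) :: W)
      = ∑ k : Fin NA ⊕ Fin ND, ∑ l : Fin NA ⊕ Fin ND, if k.isRight = s ∧ l.isRight = !s then
          letterMat (i, s) k l * (wordMat u l k * traceProd NA ND W) else 0 := by
    rw [traceProd_cons, wordTrace, Finset.sum_mul]
    refine Finset.sum_congr rfl fun k _ => ?_
    rw [wordMat_cons, Matrix.mul_apply]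
    by_cases hk : k.isRight = s
    · rw [if_pos hk, Finset.sum_mul]
      refine Finset.sum_congr rfl fun l _ => ?_
      split_ifs with h
      · ring
      · rw [letterMat_eq_zero (i, s) k l fun h' => h h']; ring
    · simp [hk]
  have h2 := congrArg gaussianExpect (sum_letterDeriv_eq (NA := NA) (ND := ND) i s u W)
  rw [map_add] at h2
  rw [h1, map_sum]
  simp_rw [map_sum]
  simp_rw [map_sum] at h2
  have h3 : ∀ {β : Type} (u : List β) (f : List β → β → List β → CoordRing NA m ND),
      gaussianExpect (splitSum u f) = splitSum u fun v l w => gaussianExpect (f v l w) :=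
    fun u f => map_splitSum (gaussianExpect (α := Idx NA m ND)).toAddMonoidHom u f
  rw [h3, h3] at h2
  simp_rw [h3, apply_ite gaussianExpect, map_zero] at h2
  simp_rw [apply_ite gaussianExpect, map_zero, gaussianExpect_letterMat_mul]
  exact h2

end Words

/-! ### Large-dimension limit of products of traces -/

section Limit

variable {m : ℕ} {R : Type*} [CommSemiring R]

/-- Auxiliary form of `limitTrace` with an explicit bound on the depth of the recursion. -/
def limitTraceAux (d : Bool → R) : ℕ → Bool → List (Letter m) → R
  | _, s, [] => d s
  | 0, _, _ :: _ => 0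
  | n + 1, s, x :: u => if x.2 = s then
      splitSum u fun v y w =>
        if y = (x.1, !s) then limitTraceAux d n (!s) v * limitTraceAux d n s w else 0
    else 0

/-- The limit of the normalised trace of a word, over `H_A` for `s = false` and over `H_D` for
`s = true`, where `d s` is the limit of the normalised dimension. It is the sum over the
noncrossing pairings of the letters of the word. -/
def limitTrace (d : Bool → R) (s : Bool) (u : List (Letter m)) : R :=
  limitTraceAux d u.length s u

theorem limitTraceAux_eq (d : Bool → R) (n k : ℕ) (s : Bool) (u : List (Letter m))
    (hn : u.length ≤ n) (hk : u.length ≤ k) :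
    limitTraceAux d n s u = limitTraceAux d k s u := by
  induction n generalizing k s u with
  | zero =>
    rw [List.length_eq_zero_iff.mp (Nat.le_zero.mp hn)]
    cases k <;> rfl
  | succ n ih =>
    rcases u with _ | ⟨x, u⟩
    · cases k <;> rfl
    · rcases k with _ | k
      · simp at hk
      · simp only [limitTraceAux]
        split_ifs
        · refine splitSum_congr fun v y w h => ?_
          simp only [h, List.length_cons, List.length_append] at hn hk
          rw [ih k (!s) v (by omega) (by omega), ih k s w (by omega) (by omega)]
        · rfl

theorem limitTrace_nil (d : Bool → R) (s : Bool) : limitTrace d s ([] : List (Letter m)) = d s := by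
  simp [limitTrace, limitTraceAux]

theorem limitTrace_cons_of_ne (d : Bool → R) {s : Bool} {x : Letter m} (h : x.2 ≠ s)
    (u : List (Letter m)) : limitTrace d s (x :: u) = 0 := by
  simp [limitTrace, limitTraceAux, h]

theorem limitTrace_cons (d : Bool → R) (i : Fin m × Fin m) (s : Bool) (u : List (Letter m)) :
    limitTrace d s ((i, s) :: u) = splitSum u fun v y w =>
      if y = (i, !s) then limitTrace d (!s) v * limitTrace d s w else 0 := by
  simp only [limitTrace, limitTraceAux, List.length_cons, if_true]
  refine splitSum_congr fun v y w h => ?_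
  rw [limitTraceAux_eq d u.length v.length (!s) v (by simp [h]) le_rfl,
    limitTraceAux_eq d u.length w.length s w (by simp [h]; omega) le_rfl]

/-- The total number of letters of a list of words. -/
def letterCount (W : List (Bool × List (Letter m))) : ℕ := (W.map fun p => p.2.length).sum

/-- Large-`N` factorisation: suitably normalised, the expectation of a product of traces of words
converges to the product of the limits for the single words. -/
theorem tendsto_traceProd (c : ℝ) (ND : ℕ → ℕ)
    (hND : Tendsto (fun NA : ℕ => (ND NA : ℂ) / NA) atTop (𝓝 c))
    (W : List (Bool × List (Letter m))) :
    Tendsto (fun NA : ℕ => gaussianExpect (traceProd NA (ND NA) W)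
        / (NA : ℂ) ^ (W.length + letterCount W / 2)) atTop
      (𝓝 (W.map fun p => limitTrace (fun s => bif s then (c : ℂ) else 1) p.1 p.2).prod) := by
  set d : Bool → ℂ := fun s => bif s then (c : ℂ) else 1 with hd
  induction hn : W.length + letterCount W using Nat.strong_induction_on generalizing W with
  | _ n ih =>
  have hne : ∀ᶠ NA : ℕ in atTop, (NA : ℂ) ≠ 0 := by
    filter_upwards [eventually_gt_atTop 0] with NA h
    exact_mod_cast h.ne'
  rcases W with _ | ⟨⟨s, _ | ⟨⟨i, t⟩, u⟩⟩, W⟩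
  · simp [traceProd, letterCount, gaussianExpect_one]
  · -- an empty word contributes the dimension of the space
    have h1 := ih (W.length + letterCount W) (by rw [← hn]; simp [letterCount]) W rfl
    have h2 : Tendsto (fun NA : ℕ => ((bif s then ND NA else NA : ℕ) : ℂ) / NA) atTop
        (𝓝 (d s)) := by
      cases s
      · refine tendsto_const_nhds.congr' ?_
        filter_upwards [hne] with NA h
        simp [hd, h]
      · simpa [hd] using hND
    rw [List.map_cons, List.prod_cons, limitTrace_nil]
    refine (h2.mul h1).congr fun NA => ?_
    rw [traceProd_cons, wordTrace_nil, ← nsmul_eq_mul, map_nsmul, nsmul_eq_mul]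
    have : letterCount ((s, ([] : List (Letter m))) :: W) = letterCount W := by simp [letterCount]
    rw [this, List.length_cons, add_right_comm, pow_succ, div_mul_div_comm, mul_comm (NA : ℂ)]
  · by_cases hts : t = s
    swap
    · rw [List.map_cons, List.prod_cons, limitTrace_cons_of_ne d hts, zero_mul]
      refine tendsto_const_nhds.congr fun NA => ?_
      rw [traceProd_cons, wordTrace_cons_of_ne hts]
      simp
    subst hts
    rw [List.map_cons, List.prod_cons, limitTrace_cons, splitSum_mul]
    simp_rw [gaussianExpect_traceProd_cons, div_eq_mul_inv, add_mul, splitSum_mul]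
    rw [← add_zero (splitSum u _)]
    have hcount : letterCount ((t, (i, t) :: u) :: W) = u.length + 1 + letterCount W := by
      simp [letterCount]
    rw [hcount] at hn ⊢
    rw [List.length_cons] at hn ⊢
    refine Tendsto.add (tendsto_splitSum fun v x w huvw => ?_) ?_
    · split_ifs
      · -- splitting: one more trace, two letters fewer
        have hc : letterCount ((!t, v) :: (t, w) :: W) + 2 = u.length + 1 + letterCount W := by
          simp [letterCount, huvw]; omega
        have h1 := ih _ (by rw [← hn, ← hc, List.length_cons, List.length_cons]; omega)
          ((!t, v) :: (t, w) :: W) rfl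
        rw [List.map_cons, List.map_cons, List.prod_cons, List.prod_cons, ← mul_assoc] at h1
        refine h1.congr fun NA => ?_
        rw [div_eq_mul_inv, ← hc, List.length_cons, List.length_cons]
        congr 3
        omega
      · simp
    · -- joining: one trace and two letters fewer
      refine tendsto_splitSum_zero fun W₁ p W₂ hW => ?_
      refine tendsto_splitSum_zero fun v x w hp => ?_
      split_ifs
      · have hc : letterCount (W₁ ++ (p.1, v ++ (u ++ w)) :: W₂) + 2
            = u.length + 1 + letterCount W := by
          simp [letterCount, hW, hp]; omega
        have hl : (W₁ ++ (p.1, v ++ (u ++ w)) :: W₂).length = W.length := by simp [hW]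
        have h1 := ih _ (by rw [← hn, ← hc, hl]; omega) (W₁ ++ (p.1, v ++ (u ++ w)) :: W₂) rfl
        have h2 : Tendsto (fun NA : ℕ => ((NA : ℂ) ^ 2)⁻¹) atTop (𝓝 0) := by
          have := tendsto_inv_atTop_nhds_zero_nat (𝕜 := ℂ)
          simpa [inv_pow] using this.pow 2
        have h3 := h1.mul h2
        rw [mul_zero] at h3
        refine h3.congr fun NA => ?_
        rw [div_eq_mul_inv, mul_assoc, ← mul_inv, ← pow_add, ← hc, hl]
        congr 3
        omega
      · simp
      · simp

end Limit

/-! ### Sums over block indices -/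

/-- The block in row `x` and column `y` of the `p`-th factor of the periodic product
`Y Yᴴ Z Zᴴ Y Yᴴ Z Zᴴ ⋯`, where `Y = (X_{bc})` with `V_AB = Y Yᴴ` and `Z = (X_{bc})` with rows
indexed by `c` and columns by `b`, so that `V_AC = Z Zᴴ`. -/
def blockLetter {m : ℕ} (p : ℕ) (x y : Fin m) : Letter m :=
  (if p % 4 = 1 ∨ p % 4 = 2 then (y, x) else (x, y), p.bodd)

/-- The sum of `f u` over the words `u` that make up the block in row `x` and column `y` of the
product of `n` consecutive factors of `Y Yᴴ Z Zᴴ ⋯`, from the `p`-th one on. -/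
def pathSum {m : ℕ} {M : Type*} [AddCommMonoid M] :
    ℕ → ℕ → Fin m → Fin m → (List (Letter m) → M) → M
  | _, 0, x, y, f => if x = y then f [] else 0
  | p, n + 1, x, y, f => ∑ z, pathSum (p + 1) n z y fun u => f (blockLetter p x z :: u)

section PathSum

variable {m : ℕ} {M N : Type*} [AddCommMonoid M] [AddCommMonoid N]

theorem map_pathSum (φ : M →+ N) (p n : ℕ) (x y : Fin m) (f : List (Letter m) → M) :
    φ (pathSum p n x y f) = pathSum p n x y fun u => φ (f u) := by
  induction n generalizing p x f with
  | zero => simp only [pathSum]; split_ifs <;> simp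
  | succ n ih => simp only [pathSum, map_sum, ih]

theorem pathSum_add (p n : ℕ) (x y : Fin m) (f g : List (Letter m) → M) :
    pathSum p n x y (fun u => f u + g u) = pathSum p n x y f + pathSum p n x y g := by
  induction n generalizing p x f g with
  | zero => simp only [pathSum]; split_ifs <;> simp
  | succ n ih => simp only [pathSum, ih, Finset.sum_add_distrib]

theorem pathSum_zero (p n : ℕ) (x y : Fin m) : pathSum p n x y (fun _ => (0 : M)) = 0 := by
  induction n generalizing p x with
  | zero => simp [pathSum]
  | succ n ih => simp [pathSum, ih]

theorem pathSum_mul_pathSum {R : Type*} [NonUnitalNonAssocSemiring R] (p q k j : ℕ)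
    (x x' y y' : Fin m) (f g : List (Letter m) → R) :
    (pathSum p k x x' fun v => pathSum q j y y' fun w => f v * g w)
      = pathSum p k x x' f * pathSum q j y y' g := by
  refine Eq.trans ?_ (map_pathSum (AddMonoidHom.mulRight _) p k x x' f).symm
  congr 1
  ext v
  exact (map_pathSum (AddMonoidHom.mulLeft (f v)) q j y y' g).symm

/-- Singling out a letter of a word cuts the path of block indices into two paths. -/
theorem pathSum_splitSum (p n : ℕ) (x y : Fin m)
    (f : List (Letter m) → Letter m → List (Letter m) → M) :
    pathSum p n x y (fun u => splitSum u f)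
      = ∑ k ∈ Finset.range n, ∑ z, ∑ z', pathSum p k x z fun v =>
          pathSum (p + k + 1) (n - 1 - k) z' y fun w => f v (blockLetter (p + k) z z') w := by
  induction n generalizing p x f with
  | zero => simp [pathSum, splitSum]
  | succ n ih =>
    rw [Finset.sum_range_succ']
    simp only [pathSum, splitSum, pathSum_add, Finset.sum_add_distrib, ih]
    rw [add_comm]
    congr 1
    · rw [Finset.sum_comm]
      refine Finset.sum_congr rfl fun k _ => ?_
      rw [Finset.sum_comm, Finset.sum_congr rfl fun z _ => Finset.sum_comm]
      have h1 : p + 1 + k = p + (k + 1) := by omega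
      have h2 : n + 1 - 1 - (k + 1) = n - 1 - k := by omega
      rw [h1, h2]
    · rw [Finset.sum_comm]
      simp

end PathSum

section Moments

variable {R : Type*} [CommSemiring R]

/-- The diagonal entries of the limits of the normalised partial traces, over `H_A` for
`t = false` and over `H_D` for `t = true`, of `2 k` consecutive factors of `Y Yᴴ Z Zᴴ ⋯`. The
first factor is paired with the `(2 j + 2)`-nd one; the closed index loop enclosed by the two
gives a factor `m` if they are adjoint to each other. -/
def limitMoment (d : Bool → R) (m : R) (t : Bool) : ℕ → R
  | 0 => d t
  | k + 1 => ∑ j : Fin (k + 1),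
      (if (j : ℕ).bodd = t then m else 1) * limitMoment d m (!t) j * limitMoment d m t (k - j)
termination_by k => k

theorem limitMoment_zero (d : Bool → R) (m : R) (t : Bool) : limitMoment d m t 0 = d t := by
  rw [limitMoment]

theorem limitMoment_succ (d : Bool → R) (m : R) (t : Bool) (k : ℕ) :
    limitMoment d m t (k + 1) = ∑ j ∈ Finset.range (k + 1),
      (if j.bodd = t then m else 1) * limitMoment d m (!t) j * limitMoment d m t (k - j) := by
  rw [limitMoment, Finset.sum_range]

theorem sum_range_of_odd_eq_zero {M : Type*} [AddCommMonoid M] (f : ℕ → M)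
    (hf : ∀ j, f (2 * j + 1) = 0) (n : ℕ) :
    ∑ k ∈ Finset.range (2 * n + 1), f k = ∑ j ∈ Finset.range (n + 1), f (2 * j) := by
  induction n with
  | zero => simp
  | succ n ih =>
    rw [show 2 * (n + 1) + 1 = 2 * n + 1 + 1 + 1 by ring, Finset.sum_range_succ,
      Finset.sum_range_succ, hf, add_zero, ih, Finset.sum_range_succ _ (n + 1)]
    rfl

variable {m : ℕ}

/-- The number of block indices `z` left free when the `p`-th factor, with indices `x z`, is paired
with the `2 j + 1`-st factor after it, with indices `z y`: all `m` of them if the two factors are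
adjoint to each other (`Y` and `Yᴴ`, or `Z` and `Zᴴ`), and the single value `z = x` otherwise. -/
theorem sum_blockLetter_eq (p j : ℕ) (x y : Fin m) (r : R) :
    (∑ z, if blockLetter (p + 1 + 2 * j) z y = ((blockLetter p x z).1, !p.bodd) then r else 0)
      = if x = y then (if j.bodd = p.bodd then (m : R) else 1) * r else 0 := by
  have hb : (p + 1 + 2 * j).bodd = !p.bodd := by
    rw [Nat.bodd_add, Nat.bodd_mul, Nat.bodd_two, Nat.bodd_succ]; simp
  have hj := Nat.mod_two_of_bodd j
  have hp := Nat.mod_two_of_bodd p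
  by_cases h : j.bodd = p.bodd
  · have : ∀ z, (blockLetter (p + 1 + 2 * j) z y = ((blockLetter p x z).1, !p.bodd)) ↔ x = y := by
      intro z
      rw [h, ← hp] at hj
      have h4 : p % 4 = 0 ∨ p % 4 = 1 ∨ p % 4 = 2 ∨ p % 4 = 3 := by omega
      rcases h4 with h4 | h4 | h4 | h4
      · have h5 : (p + 1 + 2 * j) % 4 = 1 := by omega
        simp [blockLetter, hb, h4, h5, eq_comm]
      · have h5 : (p + 1 + 2 * j) % 4 = 0 := by omega
        simp [blockLetter, hb, h4, h5, eq_comm]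
      · have h5 : (p + 1 + 2 * j) % 4 = 3 := by omega
        simp [blockLetter, hb, h4, h5, eq_comm]
      · have h5 : (p + 1 + 2 * j) % 4 = 2 := by omega
        simp [blockLetter, hb, h4, h5, eq_comm]
    simp_rw [this]
    split_ifs <;> simp
  · have : ∀ z, (blockLetter (p + 1 + 2 * j) z y = ((blockLetter p x z).1, !p.bodd))
        ↔ x = z ∧ x = y := by
      intro z
      have h4 : p % 4 = 0 ∨ p % 4 = 1 ∨ p % 4 = 2 ∨ p % 4 = 3 := by omega
      have h6 : j % 2 ≠ p % 2 := by
        rw [hj, hp]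
        revert h
        cases j.bodd <;> cases p.bodd <;> simp
      rcases h4 with h4 | h4 | h4 | h4
      · have h5 : (p + 1 + 2 * j) % 4 = 3 := by omega
        simp [blockLetter, hb, h4, h5]; grind
      · have h5 : (p + 1 + 2 * j) % 4 = 2 := by omega
        simp [blockLetter, hb, h4, h5]; grind
      · have h5 : (p + 1 + 2 * j) % 4 = 1 := by omega
        simp [blockLetter, hb, h4, h5]; grind
      · have h5 : (p + 1 + 2 * j) % 4 = 0 := by omega
        simp [blockLetter, hb, h4, h5]; grind
    simp_rw [this, ite_and]
    simp [h]

/-- The limits of the normalised partial traces of `n` consecutive factors of `Y Yᴴ Z Zᴴ ⋯` are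
multiples of the identity matrix in the block indices, and vanish for odd `n`. -/
theorem pathSum_limitTrace (d : Bool → R) (p n : ℕ) (x y : Fin m) :
    pathSum p n x y (limitTrace d p.bodd)
      = if x = y then (if n.bodd then 0 else limitMoment d (m : R) p.bodd (n / 2)) else 0 := by
  induction n using Nat.strong_induction_on generalizing p x y with
  | _ n ih =>
  rcases n with _ | n
  · simp [pathSum, limitTrace_nil, limitMoment_zero]
  have hlt : ∀ z u, limitTrace d p.bodd (blockLetter p x z :: u) = splitSum u fun v l w =>
      if l = ((blockLetter p x z).1, !p.bodd) then
        limitTrace d (!p.bodd) v * limitTrace d p.bodd w else 0 :=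
    fun z u => limitTrace_cons d (blockLetter p x z).1 p.bodd u
  simp only [pathSum, hlt, pathSum_splitSum]
  rw [Finset.sum_comm]
  have hterm : ∀ k ∈ Finset.range n, (∑ z, ∑ z₁, ∑ z₂, pathSum (p + 1) k z z₁ fun v =>
      pathSum (p + 1 + k + 1) (n - 1 - k) z₂ y fun w =>
        if blockLetter (p + 1 + k) z₁ z₂ = ((blockLetter p x z).1, !p.bodd) then
          limitTrace d (!p.bodd) v * limitTrace d p.bodd w else 0)
      = if k.bodd then 0 else if (n - 1 - k).bodd then 0 else if x = y then
          (if (k / 2).bodd = p.bodd then (m : R) else 1) *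
            limitMoment d (m : R) (!p.bodd) (k / 2) * limitMoment d (m : R) p.bodd ((n - 1 - k) / 2)
        else 0 := by
    intro k hk
    rw [Finset.mem_range] at hk
    by_cases hkb : k.bodd
    · have : ∀ z z₁ z₂ : Fin m,
          ¬ blockLetter (p + 1 + k) z₁ z₂ = ((blockLetter p x z).1, !p.bodd) := by
        intro z z₁ z₂ h
        have := congrArg Prod.snd h
        simp [blockLetter, hkb] at this
      simp [this, pathSum_zero, hkb]
    · obtain ⟨j, rfl⟩ : ∃ j, k = 2 * j := by
        have := Nat.mod_two_of_bodd k
        simp only [hkb, Bool.toNat_false] at this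
        exact ⟨k / 2, by omega⟩
      rw [Nat.mul_div_cancel_left j two_pos]
      have hb1 : (p + 1).bodd = !p.bodd := Nat.bodd_succ p
      have hb2 : (p + 1 + 2 * j + 1).bodd = p.bodd := by simp [hkb]
      have inner : ∀ z z₁ z₂ : Fin m, (pathSum (p + 1) (2 * j) z z₁ fun v =>
          pathSum (p + 1 + 2 * j + 1) (n - 1 - 2 * j) z₂ y fun w =>
          if blockLetter (p + 1 + (2 * j)) z₁ z₂ = ((blockLetter p x z).1, !p.bodd) then
            limitTrace d (!p.bodd) v * limitTrace d p.bodd w else 0)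
          = if z₂ = y then (if z = z₁ then (
            if blockLetter (p + 1 + (2 * j)) z₁ z₂ = ((blockLetter p x z).1, !p.bodd) then
              limitMoment d (m : R) (!p.bodd) j *
              (if (n - 1 - 2 * j).bodd then 0
                else limitMoment d (m : R) p.bodd ((n - 1 - 2 * j) / 2))
            else 0) else 0) else 0 := by
        intro z z₁ z₂
        split_ifs with hl <;> try simp [pathSum_zero]
        all_goals
          rw [pathSum_mul_pathSum, ← hb1, ih (2 * j) (by omega), ← hb2,
            ih (n - 1 - 2 * j) (by omega)]
          simp [*]
      simp_rw [inner]
      simp only [Finset.sum_ite_eq, Finset.sum_ite_eq', Finset.mem_univ, if_true]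
      rw [sum_blockLetter_eq]
      split_ifs <;> simp [mul_assoc]
  rw [Finset.sum_congr rfl hterm]
  rcases Nat.even_or_odd' n with ⟨N, rfl | rfl⟩
  · have hodd : (2 * N + 1).bodd = true := by simp
    rw [Finset.sum_eq_zero, hodd, if_pos rfl, ite_self]
    intro k hk
    rw [Finset.mem_range] at hk
    by_cases h1 : k.bodd = true
    · rw [if_pos h1]
    by_cases h2 : (2 * N - 1 - k).bodd = true
    · rw [if_neg h1, if_pos h2]
    have h3 := Nat.mod_two_of_bodd k
    have h4 := Nat.mod_two_of_bodd (2 * N - 1 - k)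
    simp only [h1, h2, Bool.toNat_false] at h3 h4
    omega
  · rw [sum_range_of_odd_eq_zero _ (by simp)]
    have h1 : (2 * N + 1 + 1) / 2 = N + 1 := by omega
    rw [h1, limitMoment_succ]
    by_cases hxy : x = y
    · simp only [hxy, if_true]
      rw [if_neg (by simp)]
      refine Finset.sum_congr rfl fun j hj => ?_
      have h2 : 2 * N + 1 - 1 - 2 * j = 2 * (N - j) := by omega
      rw [h2]
      simp
    · simp [hxy]

end Moments

/-! ### The moments of the product of marginals -/

section PathSum

variable {m : ℕ} {M : Type*} [AddCommMonoid M]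

theorem blockLetter_add_four (p : ℕ) (x y : Fin m) :
    blockLetter (p + 4) x y = blockLetter p x y := by
  simp [blockLetter]

theorem pathSum_add_four (p n : ℕ) (x y : Fin m) (f : List (Letter m) → M) :
    pathSum (p + 4) n x y f = pathSum p n x y f := by
  induction n generalizing p x f with
  | zero => rfl
  | succ n ih => simp only [pathSum, blockLetter_add_four, Nat.add_right_comm p 4 1, ih]

theorem tendsto_pathSum [TopologicalSpace M] [ContinuousAdd M] {κ : Type*} {F : Filter κ}
    {p n : ℕ} {x y : Fin m} {f : κ → List (Letter m) → M} {g : List (Letter m) → M}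
    (h : ∀ u, u.length = n → Tendsto (fun k => f k u) F (𝓝 (g u))) :
    Tendsto (fun k => pathSum p n x y (f k)) F (𝓝 (pathSum p n x y g)) := by
  induction n generalizing p x f g with
  | zero =>
    simp only [pathSum]
    split_ifs
    · exact h [] rfl
    · exact tendsto_const_nhds
  | succ n ih =>
    exact tendsto_finsetSum _ fun z _ => ih fun u hu => h _ (by simp [hu])

end PathSum

section Trace

variable {NA m ND : ℕ}

theorem pathSum_wordMat_succ (X : Tensor NA m ND) (p n : ℕ) (x y : Fin m)
    (k l : Fin NA ⊕ Fin ND) :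
    pathSum p (n + 1) x y (fun u => conjPairEval X (wordMat u k l))
      = ∑ z, ∑ k', conjPairEval X (letterMat (blockLetter p x z) k k') *
          pathSum (p + 1) n z y fun u => conjPairEval X (wordMat u k' l) := by
  simp only [pathSum, wordMat_cons, Matrix.mul_apply, map_sum, map_mul]
  refine Finset.sum_congr rfl fun z _ => ?_
  have h : ∀ k' : Fin NA ⊕ Fin ND, conjPairEval X (letterMat (blockLetter p x z) k k') *
      (pathSum (p + 1) n z y fun u => conjPairEval X (wordMat u k' l))
      = pathSum (p + 1) n z y fun u => conjPairEval X (letterMat (blockLetter p x z) k k') *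
          conjPairEval X (wordMat u k' l) :=
    fun k' => map_pathSum (AddMonoidHom.mulLeft _) _ _ _ _ _
  simp_rw [h]
  generalize conjPairEval X = φ
  induction (Finset.univ : Finset (Fin NA ⊕ Fin ND)) using Finset.induction_on with
  | empty => simp [pathSum_zero]
  | insert a s ha ih => simp_rw [Finset.sum_insert ha, pathSum_add, ih]

theorem conjPairEval_X_false (X : Tensor NA m ND) (i : Idx NA m ND) :
    conjPairEval X (MvPolynomial.X (i, false)) = X i := by
  simp [conjPairEval]

theorem conjPairEval_X_true (X : Tensor NA m ND) (i : Idx NA m ND) :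
    conjPairEval X (MvPolynomial.X (i, true)) = star (X i) := by
  simp [conjPairEval]

theorem sum_sum_comm {A B C D : Type*} [Fintype A] [Fintype B] [Fintype C] [Fintype D]
    (f : C → D → B → A → ℂ) :
    ∑ c, ∑ d, ∑ b, ∑ a, f c d b a = ∑ a, ∑ b, ∑ c, ∑ d, f c d b a :=
  calc ∑ c, ∑ d, ∑ b, ∑ a, f c d b a
      = ∑ p : C × D, ∑ q : A × B, f p.1 p.2 q.2 q.1 := by
        simp_rw [Fintype.sum_prod_type]
        exact Finset.sum_congr rfl fun c _ => Finset.sum_congr rfl fun d _ => Finset.sum_comm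
    _ = ∑ q : A × B, ∑ p : C × D, f p.1 p.2 q.2 q.1 := Finset.sum_comm
    _ = _ := by simp_rw [Fintype.sum_prod_type]

theorem pathSum_wordMat_marginalAB (X : Tensor NA m ND) {p : ℕ} (hp : p % 4 = 0) (n : ℕ)
    (x y : Fin m) (a : Fin NA) (l : Fin NA ⊕ Fin ND) :
    pathSum p (n + 2) x y (fun u => conjPairEval X (wordMat u (.inl a) l))
      = ∑ j : Fin NA × Fin m, marginalAB X (a, x) j *
          pathSum (p + 2) n j.2 y fun u => conjPairEval X (wordMat u (.inl j.1) l) := by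
  have hb : p.bodd = false := by
    have := Nat.mod_two_of_bodd p
    cases h : p.bodd
    · rfl
    · simp [h] at this; omega
  have h1 : (p + 1) % 4 = 1 := by omega
  have e1 : ∀ z, blockLetter p x z = ((x, z), false) := fun z => by
    simp [blockLetter, hp, hb]
  have e2 : ∀ z w : Fin m, blockLetter (p + 1) z w = ((w, z), true) := fun z w => by
    simp [blockLetter, h1, hb]
  rw [pathSum_wordMat_succ]
  simp_rw [pathSum_wordMat_succ (p := p + 1)]
  simp only [e1, e2, Fintype.sum_sum_type, letterMat, Matrix.of_apply, map_zero, zero_mul,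
    Finset.sum_const_zero, zero_add, add_zero, conjPairEval_X_false, conjPairEval_X_true,
    marginalAB, Finset.sum_mul, Finset.mul_sum]
  rw [Fintype.sum_prod_type, sum_sum_comm]
  simp_rw [mul_assoc]

theorem pathSum_wordMat_marginalAC (X : Tensor NA m ND) {p : ℕ} (hp : p % 4 = 2) (n : ℕ)
    (x y : Fin m) (a : Fin NA) (l : Fin NA ⊕ Fin ND) :
    pathSum p (n + 2) x y (fun u => conjPairEval X (wordMat u (.inl a) l))
      = ∑ j : Fin NA × Fin m, marginalAC X (a, x) j *
          pathSum (p + 2) n j.2 y fun u => conjPairEval X (wordMat u (.inl j.1) l) := by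
  have hb : p.bodd = false := by
    have := Nat.mod_two_of_bodd p
    cases h : p.bodd
    · rfl
    · simp [h] at this; omega
  have h1 : (p + 1) % 4 = 3 := by omega
  have e1 : ∀ z, blockLetter p x z = ((z, x), false) := fun z => by
    simp [blockLetter, hp, hb]
  have e2 : ∀ z w : Fin m, blockLetter (p + 1) z w = ((z, w), true) := fun z w => by
    simp [blockLetter, h1, hb]
  rw [pathSum_wordMat_succ]
  simp_rw [pathSum_wordMat_succ (p := p + 1)]
  simp only [e1, e2, Fintype.sum_sum_type, letterMat, Matrix.of_apply, map_zero, zero_mul,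
    Finset.sum_const_zero, zero_add, add_zero, conjPairEval_X_false, conjPairEval_X_true,
    marginalAC, Finset.sum_mul, Finset.mul_sum]
  rw [Fintype.sum_prod_type, sum_sum_comm]
  simp_rw [mul_assoc]

theorem marginal_pow_apply (X : Tensor NA m ND) (n : ℕ) (a a' : Fin NA) (x x' : Fin m) :
    ((marginalAB X * marginalAC X) ^ n) (a, x) (a', x')
      = pathSum 0 (4 * n) x x' fun u => conjPairEval X (wordMat u (.inl a) (.inl a')) := by
  induction n generalizing a x with
  | zero =>
    simp only [pow_zero, Matrix.one_apply, Prod.mk.injEq, pathSum, wordMat, List.map_nil,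
      List.prod_nil, Sum.inl.injEq]
    by_cases h : a = a' <;> by_cases h' : x = x' <;> simp [h, h']
  | succ n ih =>
    rw [pow_succ', show 4 * (n + 1) = 4 * n + 2 + 2 by ring,
      pathSum_wordMat_marginalAB X (by rfl), mul_assoc, Matrix.mul_apply]
    refine Finset.sum_congr rfl fun j _ => ?_
    rw [pathSum_wordMat_marginalAC X (by rfl), Matrix.mul_apply]
    congr 1
    refine Finset.sum_congr rfl fun j' _ => ?_
    rw [show 0 + 2 + 2 = 0 + 4 from rfl, pathSum_add_four, ← ih]

theorem trace_mul_pow_comm {n : Type*} [Fintype n] [DecidableEq n] (A B : Matrix n n ℂ) (k : ℕ) :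
    ((A * B) ^ k).trace = ((B * A) ^ k).trace := by
  rcases k with _ | k
  · simp
  · have h : ∀ j, (A * B) ^ (j + 1) = A * ((B * A) ^ j * B) := by
      intro j
      induction j with
      | zero => simp
      | succ j ih => rw [pow_succ, ih, pow_succ]; simp only [mul_assoc]
    rw [h, Matrix.trace_mul_comm, mul_assoc, ← pow_succ]

open scoped ComplexOrder in
theorem posSemidef_marginalAB (X : Tensor NA m ND) : (marginalAB X).PosSemidef := by
  have : marginalAB X = (Matrix.of fun (p : Fin NA × Fin m) (q : Fin m × Fin ND) =>
      X (p.1, p.2, q.1, q.2)) * (Matrix.of fun (p : Fin NA × Fin m) (q : Fin m × Fin ND) =>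
      X (p.1, p.2, q.1, q.2)).conjTranspose := by
    ext p q
    simp [marginalAB, Matrix.mul_apply, Fintype.sum_prod_type]
  rw [this]
  exact Matrix.posSemidef_self_mul_conjTranspose _

open scoped ComplexOrder in
theorem trace_productOfMarginals_pow (X : Tensor NA m ND) (n : ℕ) :
    (productOfMarginals X ^ n).trace
      = conjPairEval X (∑ x, pathSum 0 (4 * n) x x (wordTrace NA ND false)) := by
  rw [productOfMarginals, trace_mul_pow_comm, ← mul_assoc,
    CFC.sqrt_mul_sqrt_self _ (posSemidef_marginalAB X).nonneg, Matrix.trace,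
    Fintype.sum_prod_type_right, map_sum]
  refine Finset.sum_congr rfl fun x _ => ?_
  simp only [Matrix.diag_apply, marginal_pow_apply]
  have h : conjPairEval X (pathSum 0 (4 * n) x x (wordTrace NA ND false))
      = pathSum 0 (4 * n) x x fun u => conjPairEval X (wordTrace NA ND false u) :=
    map_pathSum (conjPairEval X).toRingHom.toAddMonoidHom _ _ _ _ _
  rw [h]
  simp only [wordTrace, Fintype.sum_sum_type, Sum.isRight_inl, Sum.isRight_inr, if_true,
    Bool.true_eq_false, if_false, Finset.sum_const_zero, add_zero, map_sum]
  generalize conjPairEval X = φ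
  induction (Finset.univ : Finset (Fin NA)) using Finset.induction_on with
  | empty => simp [pathSum_zero]
  | insert a s ha ih => simp_rw [Finset.sum_insert ha, pathSum_add, ih]

theorem integrable_trace_productOfMarginals_pow (NA m ND n : ℕ) :
    Integrable (fun X : Tensor NA m ND => (productOfMarginals X ^ n).trace)
      (gaussianTensor NA m ND) := by
  simp_rw [trace_productOfMarginals_pow]
  exact integrable_conjPairEval _

theorem normalizedMoment_eq (NA m ND n : ℕ) :
    normalizedMoment m NA ND n = (∑ x : Fin m, pathSum 0 (4 * n) x x fun u =>
      gaussianExpect (traceProd NA ND [(false, u)]) / (NA : ℂ) ^ (2 * n + 1))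
        / (m : ℂ) ^ (2 * n + 1) := by
  have h1 : ∫ X, (productOfMarginals X ^ n).trace ∂(gaussianTensor NA m ND)
      = gaussianExpect (∑ x : Fin m, pathSum 0 (4 * n) x x (wordTrace NA ND false)) := by
    simp_rw [trace_productOfMarginals_pow]
    rfl
  have h2 : ∀ (x : Fin m), gaussianExpect (pathSum 0 (4 * n) x x (wordTrace NA ND false))
      / (NA : ℂ) ^ (2 * n + 1)
      = pathSum 0 (4 * n) x x fun u =>
          gaussianExpect (wordTrace NA ND false u) / (NA : ℂ) ^ (2 * n + 1) := by
    intro x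
    have := map_pathSum (((AddMonoidHom.mulRight ((NA : ℂ) ^ (2 * n + 1))⁻¹)).comp
      (gaussianExpect (α := Idx NA m ND)).toAddMonoidHom) 0 (4 * n) x x (wordTrace NA ND false)
    simpa [div_eq_mul_inv] using this
  rw [normalizedMoment, h1, map_sum, mul_pow, mul_comm ((m : ℂ) ^ _), ← div_div, Finset.sum_div]
  simp_rw [h2]
  simp [traceProd]

theorem ofReal_limitMoment (d : Bool → ℝ) (r : ℝ) (t : Bool) (k : ℕ) :
    ((limitMoment d r t k : ℝ) : ℂ) = limitMoment (fun s => (d s : ℂ)) (r : ℂ) t k := by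
  induction k using Nat.strong_induction_on generalizing t with
  | _ k ih =>
  rcases k with _ | k
  · simp [limitMoment_zero]
  · rw [limitMoment_succ, limitMoment_succ]
    push_cast
    refine Finset.sum_congr rfl fun j hj => ?_
    rw [Finset.mem_range] at hj
    rw [ih j hj, ih (k - j) (by omega)]
    split_ifs <;> simp

/-- The limits of the normalised moments. -/
theorem tendsto_normalizedMoment (m : ℕ) (hm : 0 < m) (c : ℝ) (hc : 0 < c) (ND : ℕ → ℕ)
    (hND : (fun NA : ℕ => (ND NA : ℝ)) ~[atTop] (fun NA : ℕ => c * (NA : ℝ))) (n : ℕ) :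
    Tendsto (fun NA : ℕ => normalizedMoment m NA (ND NA) n) atTop
      (𝓝 ((limitMoment (fun s => bif s then c else 1) (m : ℝ) false (2 * n) / (m : ℝ) ^ (2 * n) :
        ℝ) : ℂ)) := by
  have hratio : Tendsto (fun NA : ℕ => (ND NA : ℂ) / NA) atTop (𝓝 c) := by
    have h0 : ∀ᶠ NA : ℕ in atTop, c * (NA : ℝ) ≠ 0 := by
      filter_upwards [eventually_gt_atTop 0] with NA h
      have : (NA : ℝ) ≠ 0 := by exact_mod_cast h.ne'
      positivity
    have h1 := ((isEquivalent_iff_tendsto_one h0).mp hND).mul_const c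
    rw [one_mul] at h1
    have h2 : Tendsto (fun NA : ℕ => (ND NA : ℝ) / NA) atTop (𝓝 c) := by
      refine h1.congr fun NA => ?_
      simp only [Pi.div_apply]
      field_simp
    have h3 := (Complex.continuous_ofReal.tendsto c).comp h2
    refine h3.congr fun NA => ?_
    simp
  simp_rw [normalizedMoment_eq]
  have hlim : ((limitMoment (fun s => bif s then c else 1) (m : ℝ) false (2 * n)
        / (m : ℝ) ^ (2 * n) : ℝ) : ℂ)
      = (∑ x : Fin m, pathSum 0 (4 * n) x x (limitTrace (fun s => bif s then (c : ℂ) else 1) false))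
        / (m : ℂ) ^ (2 * n + 1) := by
    have hm' : (m : ℂ) ≠ 0 := by exact_mod_cast hm.ne'
    have hd : (fun s : Bool => ((bif s then c else 1 : ℝ) : ℂ))
        = fun s => bif s then (c : ℂ) else 1 := by
      ext s; cases s <;> simp
    have h1 : ∀ x : Fin m, pathSum 0 (4 * n) x x
        (limitTrace (fun s => bif s then (c : ℂ) else 1) false)
        = limitMoment (fun s => bif s then (c : ℂ) else 1) (m : ℂ) false (2 * n) := by
      intro x
      have := pathSum_limitTrace (fun s => bif s then (c : ℂ) else 1) 0 (4 * n) x x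
      have h2 : 4 * n / 2 = 2 * n := by omega
      have h3 : (4 * n).bodd = false := by simp [Nat.bodd_mul]
      rw [h2, h3] at this
      simpa using this
    simp_rw [h1]
    push_cast
    rw [ofReal_limitMoment, hd]
    simp only [Finset.sum_const, Finset.card_univ, Fintype.card_fin, nsmul_eq_mul,
      Complex.ofReal_natCast]
    rw [pow_succ]
    field_simp
  rw [hlim]
  refine Tendsto.div_const (tendsto_finsetSum _ fun x _ => tendsto_pathSum fun u hu => ?_) _
  have h := tendsto_traceProd c ND hratio [(false, u)]
  have h2 : 1 + 4 * n / 2 = 2 * n + 1 := by omega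
  simpa [letterCount, hu, h2] using h

end Trace

/-! ### The algebraic equation for the generating series -/

section Algebra

variable {R : Type*} [CommRing R]

/-- The resolvent polynomial in the variables `u = 1 / z` and `E = z W`. -/
def reducedPolynomial (c y u E : R) : R :=
  u ^ 2 * E ^ 6 * (y ^ 2 - 1) ^ 2 + 3 * (c - 1) * u ^ 2 * E ^ 5 * (y ^ 2 - 1) ^ 2
  + E ^ 4 * (3 * (c - 1) ^ 2 * (y ^ 2 - 1) ^ 2 * u ^ 2 - 2 * (y ^ 2 + 1) * u)
  + E ^ 3 * ((c - 1) ^ 3 * (y ^ 2 - 1) ^ 2 * u ^ 2 - 4 * (c - 1) * (y ^ 2 + 1) * u)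
  + E ^ 2 * ((-2 * c ^ 2 * y ^ 2 - 3 * c ^ 2 + 5 * c * y ^ 2 + 5 * c - 3 * y ^ 2 - 2) * u + 1)
  + E * ((-c ^ 3 + c ^ 2 * y ^ 2 + 2 * c ^ 2 - 2 * c * y ^ 2 - c + y ^ 2) * u + (c - 1))
  - c

/-- Up to the change of variables the two polynomials agree, whenever `z` is invertible. -/
theorem resolventPolynomial_eq (c y z u E : R) (h : u * z = 1) :
    resolventPolynomial c y z (u * E) = reducedPolynomial c y u E := by
  have h2 : u ^ 2 * z ^ 2 = 1 := by rw [← mul_pow, h, one_pow]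
  have h3 : u ^ 3 * z ^ 3 = 1 := by rw [← mul_pow, h, one_pow]
  have h4 : u ^ 4 * z ^ 4 = 1 := by rw [← mul_pow, h, one_pow]
  unfold resolventPolynomial reducedPolynomial
  linear_combination
    u ^ 2 * E ^ 6 * (y ^ 2 - 1) ^ 2 * h4 + 3 * (c - 1) * u ^ 2 * E ^ 5 * (y ^ 2 - 1) ^ 2 * h3
    + E ^ 4 * (3 * (c - 1) ^ 2 * (y ^ 2 - 1) ^ 2 * u ^ 2 * h2 - 2 * (y ^ 2 + 1) * u * h3)
    + E ^ 3 * ((c - 1) ^ 3 * (y ^ 2 - 1) ^ 2 * u ^ 2 * h - 4 * (c - 1) * (y ^ 2 + 1) * u * h2)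
    + E ^ 2 * ((-2 * c ^ 2 * y ^ 2 - 3 * c ^ 2 + 5 * c * y ^ 2 + 5 * c - 3 * y ^ 2 - 2) * u * h
      + h2)
    + E * (c - 1) * h

/-- Elimination of `O`, `P`, `Q` from the equations for the even and odd parts of the generating
series of the limit moments. -/
theorem reducedPolynomial_eq_zero (c y u E O P Q : R) (hE : E = 1 + u * (P * O + y * Q * E))
    (hO : O = P * E + y * u * (Q * O)) (hP : P = c + u * (y * E * Q + O * P))
    (hQ : Q = y * E * P + u * (O * Q)) : reducedPolynomial c y u E = 0 := by
  have hPE : P = E - 1 + c := by linear_combination hP - hE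
  -- all three are `u * (P + E)` times one of `y * u * (O * Q)`, `O` and `y * Q`
  have hN : E - 1 - u * P ^ 2 * E - u * y ^ 2 * E ^ 2 * P = u * (P + E) * (y * u * (O * Q)) := by
    linear_combination hE + u * P * hO + u * y * E * hQ
  have h1 : u * P * E * (P + E) + (E - 1 - u * P ^ 2 * E - u * y ^ 2 * E ^ 2 * P)
      = u * (P + E) * O := by
    linear_combination hN - u * (P + E) * hO
  have h2 : y ^ 2 * u * E * P * (P + E) + (E - 1 - u * P ^ 2 * E - u * y ^ 2 * E ^ 2 * P)
      = u * (P + E) * (y * Q) := by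
    linear_combination hN - u * (P + E) * y * hQ
  have h3 : (P + E) * (E - 1 - u * P ^ 2 * E - u * y ^ 2 * E ^ 2 * P)
      - (u * P * E * (P + E) + (E - 1 - u * P ^ 2 * E - u * y ^ 2 * E ^ 2 * P))
        * (y ^ 2 * u * E * P * (P + E) + (E - 1 - u * P ^ 2 * E - u * y ^ 2 * E ^ 2 * P)) = 0 := by
    rw [h1, h2, hN]
    ring
  rw [hPE] at h3
  unfold reducedPolynomial
  linear_combination h3

theorem map_reducedPolynomial {S : Type*} [CommRing S] (φ : R →+* S) (c y u E : R) :
    φ (reducedPolynomial c y u E) = reducedPolynomial (φ c) (φ y) (φ u) (φ E) := by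
  simp only [reducedPolynomial, map_add, map_sub, map_mul, map_pow, map_neg, map_one, map_ofNat]

end Algebra

section GeneratingSeries

open Finset in
theorem sum_range_even_odd {M : Type*} [AddCommMonoid M] (f : ℕ → M) (n : ℕ) :
    ∑ k ∈ range (2 * n), f k = ∑ j ∈ range n, f (2 * j) + ∑ j ∈ range n, f (2 * j + 1) := by
  induction n with
  | zero => simp
  | succ n ih =>
    rw [show 2 * (n + 1) = 2 * n + 1 + 1 by ring, sum_range_succ, sum_range_succ, ih,
      sum_range_succ _ n, sum_range_succ _ n, add_assoc, add_add_add_comm]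

theorem sum_range_odd_even {M : Type*} [AddCommMonoid M] (f : ℕ → M) (n : ℕ) :
    ∑ k ∈ Finset.range (2 * n + 1), f k
      = ∑ j ∈ Finset.range (n + 1), f (2 * j) + ∑ j ∈ Finset.range n, f (2 * j + 1) := by
  rw [Finset.sum_range_succ, sum_range_even_odd, Finset.sum_range_succ _ n, add_right_comm]

variable (d : Bool → ℝ) (m : ℕ)

/-- The generating series of the limit moments of even (for `e = 0`) or odd (for `e = 1`) order,
normalised by powers of `m`. -/
noncomputable def momentSeries (t : Bool) (e : ℕ) : ℝ⟦X⟧ :=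
  PowerSeries.mk fun n => limitMoment d (m : ℝ) t (2 * n + e) / (m : ℝ) ^ (2 * n + e)

theorem coeff_momentSeries_mul (t t' : Bool) (e e' n : ℕ) :
    PowerSeries.coeff n (momentSeries d m t e * momentSeries d m t' e')
      = (∑ j ∈ Finset.range (n + 1), limitMoment d (m : ℝ) t (2 * j + e)
          * limitMoment d (m : ℝ) t' (2 * (n - j) + e')) / (m : ℝ) ^ (2 * n + e + e') := by
  rw [PowerSeries.coeff_mul, Finset.Nat.sum_antidiagonal_eq_sum_range_succ_mk, Finset.sum_div]
  refine Finset.sum_congr rfl fun j hj => ?_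
  rw [Finset.mem_range] at hj
  simp only [momentSeries, PowerSeries.coeff_mk]
  rw [div_mul_div_comm, ← pow_add]
  congr 2
  omega

variable {m}

theorem bodd_two_mul_add_one (j : ℕ) : (2 * j + 1).bodd = true := by simp

theorem bodd_two_mul (j : ℕ) : (2 * j).bodd = false := by simp

theorem limitMoment_two_mul_add_two (t : Bool) (n : ℕ) :
    limitMoment d (m : ℝ) t (2 * n + 2)
      = (if t then 1 else (m : ℝ)) * ∑ j ∈ Finset.range (n + 1),
          limitMoment d (m : ℝ) (!t) (2 * j) * limitMoment d (m : ℝ) t (2 * (n - j) + 1)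
        + (if t then (m : ℝ) else 1) * ∑ j ∈ Finset.range (n + 1),
          limitMoment d (m : ℝ) (!t) (2 * j + 1) * limitMoment d (m : ℝ) t (2 * (n - j)) := by
  rw [limitMoment_succ, show 2 * n + 1 + 1 = 2 * (n + 1) by ring, sum_range_even_odd,
    Finset.mul_sum, Finset.mul_sum]
  congr 1 <;> refine Finset.sum_congr rfl fun j hj => ?_ <;> rw [Finset.mem_range] at hj
  · rw [show 2 * n + 1 - 2 * j = 2 * (n - j) + 1 by omega, bodd_two_mul]
    cases t <;> simp [mul_assoc]
  · rw [show 2 * n + 1 - (2 * j + 1) = 2 * (n - j) by omega, bodd_two_mul_add_one]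
    cases t <;> simp [mul_assoc]

theorem limitMoment_two_mul_add_three (t : Bool) (n : ℕ) :
    limitMoment d (m : ℝ) t (2 * n + 3)
      = (if t then 1 else (m : ℝ)) * ∑ j ∈ Finset.range (n + 2),
          limitMoment d (m : ℝ) (!t) (2 * j) * limitMoment d (m : ℝ) t (2 * (n + 1 - j))
        + (if t then (m : ℝ) else 1) * ∑ j ∈ Finset.range (n + 1),
          limitMoment d (m : ℝ) (!t) (2 * j + 1) * limitMoment d (m : ℝ) t (2 * (n - j) + 1) := by
  rw [limitMoment_succ, show 2 * n + 2 + 1 = 2 * (n + 1) + 1 by ring, sum_range_odd_even,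
    Finset.mul_sum, Finset.mul_sum]
  congr 1 <;> refine Finset.sum_congr rfl fun j hj => ?_ <;> rw [Finset.mem_range] at hj
  · rw [show 2 * n + 2 - 2 * j = 2 * (n + 1 - j) by omega, bodd_two_mul]
    cases t <;> simp [mul_assoc]
  · rw [show 2 * n + 2 - (2 * j + 1) = 2 * (n - j) + 1 by omega, bodd_two_mul_add_one]
    cases t <;> simp [mul_assoc]

/-- The terms of even order of the recursion for the limit moments. -/
theorem momentSeries_zero (hm : 0 < m) (t : Bool) :
    momentSeries d m t 0 = PowerSeries.C (d t) + PowerSeries.X *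
      (PowerSeries.C (if t then 1 / (m : ℝ) else 1) *
          (momentSeries d m (!t) 0 * momentSeries d m t 1)
        + PowerSeries.C (if t then 1 else 1 / (m : ℝ)) *
          (momentSeries d m (!t) 1 * momentSeries d m t 0)) := by
  have hm' : (m : ℝ) ≠ 0 := by exact_mod_cast hm.ne'
  ext n
  rcases n with _ | n
  · simp [momentSeries, limitMoment_zero]
  · rw [map_add, PowerSeries.coeff_succ_X_mul, map_add, PowerSeries.coeff_C_mul,
      PowerSeries.coeff_C_mul, coeff_momentSeries_mul, coeff_momentSeries_mul,
      PowerSeries.coeff_C, if_neg (by omega), zero_add]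
    simp only [momentSeries, PowerSeries.coeff_mk, add_zero]
    rw [show 2 * (n + 1) = 2 * n + 2 by ring, limitMoment_two_mul_add_two]
    cases t <;> simp <;> field_simp <;> ring

/-- The terms of odd order of the recursion for the limit moments. -/
theorem momentSeries_one (hm : 0 < m) (t : Bool) :
    momentSeries d m t 1 = PowerSeries.C (if t then 1 / (m : ℝ) else 1) *
          (momentSeries d m (!t) 0 * momentSeries d m t 0)
        + PowerSeries.X * (PowerSeries.C (if t then 1 else 1 / (m : ℝ)) *
          (momentSeries d m (!t) 1 * momentSeries d m t 1)) := by
  have hm' : (m : ℝ) ≠ 0 := by exact_mod_cast hm.ne'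
  ext n
  rcases n with _ | n
  · rw [map_add, PowerSeries.coeff_C_mul, coeff_momentSeries_mul]
    simp [momentSeries, limitMoment_succ]
    cases t <;> simp <;> field_simp
  · rw [map_add, PowerSeries.coeff_succ_X_mul, PowerSeries.coeff_C_mul,
      PowerSeries.coeff_C_mul, coeff_momentSeries_mul, coeff_momentSeries_mul]
    simp only [momentSeries, PowerSeries.coeff_mk, add_zero]
    rw [show 2 * (n + 1) + 1 = 2 * n + 3 by ring, limitMoment_two_mul_add_three]
    cases t <;> simp <;> field_simp <;> ring

theorem reducedPolynomial_momentSeries (hm : 0 < m) (c : ℝ) :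
    reducedPolynomial (PowerSeries.C c) (PowerSeries.C (1 / (m : ℝ))) PowerSeries.X
      (momentSeries (fun s => bif s then c else 1) m false 0) = 0 := by
  have hF0 := momentSeries_zero (fun s => bif s then c else 1) hm false
  have hF1 := momentSeries_one (fun s => bif s then c else 1) hm false
  have hT0 := momentSeries_zero (fun s => bif s then c else 1) hm true
  have hT1 := momentSeries_one (fun s => bif s then c else 1) hm true
  simp only [Bool.false_eq_true, if_false, if_true, Bool.not_false, Bool.not_true, cond_false,
    cond_true, map_one, one_mul] at hF0 hF1 hT0 hT1
  refine reducedPolynomial_eq_zero _ _ _ _ (momentSeries (fun s => bif s then c else 1) m false 1)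
    (momentSeries (fun s => bif s then c else 1) m true 0)
    (momentSeries (fun s => bif s then c else 1) m true 1) ?_ ?_ ?_ ?_
  · linear_combination hF0
  · linear_combination hF1
  · linear_combination hT0
  · linear_combination hT1

end GeneratingSeries

/-! ### Convergence -/

section Convergence

/-- The real power series that converge absolutely at `u`. -/
def convergentSeries (u : ℂ) : Subring ℝ⟦X⟧ where
  carrier := {f | Summable fun n => ‖((PowerSeries.coeff n f : ℝ) : ℂ) * u ^ n‖}
  mul_mem' {f g} hf hg := by
    refine (summable_norm_sum_mul_antidiagonal_of_summable_norm hf hg).congr fun n => ?_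
    rw [PowerSeries.coeff_mul]
    push_cast
    rw [Finset.sum_mul]
    refine congrArg norm (Finset.sum_congr rfl fun p hp => ?_)
    rw [← Finset.HasAntidiagonal.mem_antidiagonal.mp hp, pow_add]
    ring
  one_mem' := summable_of_ne_finset_zero (s := {0}) fun n hn => by
    have : n ≠ 0 := by simpa using hn
    simp [PowerSeries.coeff_one, this]
  add_mem' {f g} hf hg := by
    refine Summable.of_nonneg_of_le (fun n => norm_nonneg _) (fun n => ?_) (hf.add hg)
    rw [map_add, Complex.ofReal_add, add_mul]
    exact norm_add_le _ _
  zero_mem' := by simp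
  neg_mem' {f} hf := by simpa using hf

/-- Evaluation at `u` of the power series that converge absolutely there. -/
noncomputable def evalSeries (u : ℂ) : convergentSeries u →+* ℂ where
  toFun f := ∑' n, ((PowerSeries.coeff n (f : ℝ⟦X⟧) : ℝ) : ℂ) * u ^ n
  map_one' := by
    rw [tsum_eq_single 0 fun n hn => by simp [PowerSeries.coeff_one, hn]]
    simp
  map_mul' f g := by
    rw [tsum_mul_tsum_eq_tsum_sum_antidiagonal_of_summable_norm f.2 g.2]
    refine tsum_congr fun n => ?_
    rw [Subring.coe_mul, PowerSeries.coeff_mul]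
    push_cast
    rw [Finset.sum_mul]
    refine Finset.sum_congr rfl fun p hp => ?_
    rw [← Finset.HasAntidiagonal.mem_antidiagonal.mp hp, pow_add]
    ring
  map_zero' := by simp
  map_add' f g := by
    rw [← (Summable.of_norm f.2).tsum_add (Summable.of_norm g.2)]
    refine tsum_congr fun n => ?_
    simp [add_mul]

theorem C_mem_convergentSeries (u : ℂ) (r : ℝ) : PowerSeries.C r ∈ convergentSeries u :=
  summable_of_ne_finset_zero (s := {0}) fun n hn => by
    have : n ≠ 0 := by simpa using hn
    simp [PowerSeries.coeff_C, this]

theorem X_mem_convergentSeries (u : ℂ) : (PowerSeries.X : ℝ⟦X⟧) ∈ convergentSeries u :=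
  summable_of_ne_finset_zero (s := {1}) fun n hn => by
    have : n ≠ 1 := by simpa using hn
    simp [PowerSeries.coeff_X, this]

theorem evalSeries_C (u : ℂ) (r : ℝ) :
    evalSeries u ⟨PowerSeries.C r, C_mem_convergentSeries u r⟩ = r := by
  change ∑' n, ((PowerSeries.coeff n (PowerSeries.C r) : ℝ) : ℂ) * u ^ n = r
  rw [tsum_eq_single 0 fun n hn => by simp [PowerSeries.coeff_C, hn]]
  simp

theorem evalSeries_X (u : ℂ) :
    evalSeries u ⟨PowerSeries.X, X_mem_convergentSeries u⟩ = u := by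
  change ∑' n, ((PowerSeries.coeff n (PowerSeries.X : ℝ⟦X⟧) : ℝ) : ℂ) * u ^ n = u
  rw [tsum_eq_single 1 fun n hn => by simp [PowerSeries.coeff_X, hn]]
  simp

/-- A formal solution of the reduced equation solves it at every point of absolute convergence. -/
theorem reducedPolynomial_evalSeries {c y : ℝ} {f : ℝ⟦X⟧} {u : ℂ} (hf : f ∈ convergentSeries u)
    (h : reducedPolynomial (PowerSeries.C c) (PowerSeries.C y) PowerSeries.X f = 0) :
    reducedPolynomial (c : ℂ) (y : ℂ) u (∑' n, ((PowerSeries.coeff n f : ℝ) : ℂ) * u ^ n) = 0 := by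
  have h1 : reducedPolynomial (⟨PowerSeries.C c, C_mem_convergentSeries u c⟩ : convergentSeries u)
      ⟨PowerSeries.C y, C_mem_convergentSeries u y⟩ ⟨PowerSeries.X, X_mem_convergentSeries u⟩
      ⟨f, hf⟩ = 0 := by
    apply Subtype.val_injective
    have := map_reducedPolynomial (convergentSeries u).subtype
      ⟨PowerSeries.C c, C_mem_convergentSeries u c⟩
      ⟨PowerSeries.C y, C_mem_convergentSeries u y⟩ ⟨PowerSeries.X, X_mem_convergentSeries u⟩
      ⟨f, hf⟩
    exact this.trans h
  have h2 := congrArg (evalSeries u) h1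
  rw [map_reducedPolynomial, evalSeries_C, evalSeries_C, evalSeries_X, map_zero] at h2
  exact h2

theorem catalan_le_four_pow (n : ℕ) : catalan n ≤ 4 ^ n := by
  rw [catalan_eq_centralBinom_div]
  calc n.centralBinom / (n + 1) ≤ n.centralBinom := Nat.div_le_self _ _
    _ ≤ 2 ^ (2 * n) := Nat.choose_le_two_pow _ _
    _ = 4 ^ n := by rw [pow_mul]; norm_num

theorem limitMoment_nonneg {d : Bool → ℝ} (hd : ∀ s, 0 ≤ d s) {r : ℝ} (hr : 0 ≤ r) (t : Bool)
    (k : ℕ) : 0 ≤ limitMoment d r t k := by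
  induction k using Nat.strong_induction_on generalizing t with
  | _ k ih =>
  rcases k with _ | k
  · rw [limitMoment_zero]; exact hd t
  · rw [limitMoment_succ]
    refine Finset.sum_nonneg fun j hj => ?_
    rw [Finset.mem_range] at hj
    have h1 := ih j hj (!t)
    have h2 := ih (k - j) (by omega) t
    split_ifs <;> positivity

/-- Bounding all weights by `r`, the recursion becomes that of the Catalan numbers. -/
theorem limitMoment_le_catalan {d : Bool → ℝ} (hd : ∀ s, 0 ≤ d s) {r D : ℝ} (hr : 1 ≤ r)
    (hD : ∀ s, d s ≤ D) (t : Bool) (k : ℕ) :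
    limitMoment d r t k ≤ D * (r * D) ^ k * catalan k := by
  have hD0 : 0 ≤ D := (hd true).trans (hD true)
  induction k using Nat.strong_induction_on generalizing t with
  | _ k ih =>
  rcases k with _ | k
  · simpa [limitMoment_zero] using hD t
  · have hsum : D * (r * D) ^ (k + 1) * (catalan (k + 1) : ℝ)
        = ∑ j ∈ Finset.range (k + 1), r * (D * (r * D) ^ j * catalan j)
            * (D * (r * D) ^ (k - j) * catalan (k - j)) := by
      rw [catalan_succ, Nat.cast_sum, Finset.mul_sum, Finset.sum_range]
      refine Finset.sum_congr rfl fun j _ => ?_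
      have : (r * D) ^ (k + 1) = r * D * ((r * D) ^ (j : ℕ) * (r * D) ^ (k - j)) := by
        rw [← pow_add, ← pow_succ']
        congr 1
        omega
      rw [this]
      push_cast
      ring
    rw [limitMoment_succ, hsum]
    refine Finset.sum_le_sum fun j hj => ?_
    rw [Finset.mem_range] at hj
    have h0 := limitMoment_nonneg hd (zero_le_one.trans hr) (!t) j
    have h1 := ih j hj (!t)
    have h2 := ih (k - j) (by omega) t
    have h3 := limitMoment_nonneg hd (zero_le_one.trans hr) t (k - j)
    refine mul_le_mul (mul_le_mul ?_ h1 h0 (zero_le_one.trans hr)) h2 h3 (by positivity)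
    split_ifs
    · exact le_rfl
    · exact hr

end Convergence

end RandomTensor

theorem theorem3p1 (m : ℕ) (hm : 0 < m) (c : ℝ) (hc : 0 < c) :
    -- all moments are finite
    (∀ NA ND n : ℕ, Integrable
      (fun X : RandomTensor.Tensor NA m ND => (RandomTensor.productOfMarginals X ^ n).trace)
      (RandomTensor.gaussianTensor NA m ND)) ∧
    ∃ M : ℕ → ℝ,
      -- `M n` is the limit of the normalised moments when `N_A → ∞` and `N_D ∼ c N_A`
      (∀ ND : ℕ → ℕ,
        (fun NA : ℕ => (ND NA : ℝ)) ~[atTop] (fun NA : ℕ => c * (NA : ℝ)) →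
        ∀ n : ℕ, Tendsto (fun NA : ℕ => RandomTensor.normalizedMoment m NA (ND NA) n) atTop
          (𝓝 (M n : ℂ))) ∧
      -- the equation for the resolvent as a formal series in `1 / z`
      RandomTensor.resolventPolynomial (HahnSeries.C c) (HahnSeries.C (1 / (m : ℝ)))
        RandomTensor.formalZ (RandomTensor.formalResolvent M) = 0 ∧
      -- the series converges near `z = ∞`
      (∃ R : ℝ, ∀ z : ℂ, R < ‖z‖ → Summable (RandomTensor.resolventTerm M z)) ∧
      -- the equation for its sum, wherever the series converges
      ∀ z : ℂ, z ≠ 0 → Summable (RandomTensor.resolventTerm M z) →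
        RandomTensor.resolventPolynomial (c : ℂ) (1 / (m : ℂ)) z
          (∑' n : ℕ, RandomTensor.resolventTerm M z n) = 0 := by
  open RandomTensor in
  set d : Bool → ℝ := fun s => bif s then c else 1 with hd
  have hmR : (0 : ℝ) < m := by exact_mod_cast hm
  have hred := reducedPolynomial_momentSeries hm c
  have hmk : momentSeries d m false 0
      = PowerSeries.mk fun n => limitMoment d (m : ℝ) false (2 * n) / (m : ℝ) ^ (2 * n) := rfl
  refine ⟨fun NA ND n => integrable_trace_productOfMarginals_pow NA m ND n,
    fun n => limitMoment d (m : ℝ) false (2 * n) / (m : ℝ) ^ (2 * n),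
    fun ND hND n => tendsto_normalizedMoment m hm c hc ND hND n, ?_, ?_, ?_⟩
  · have h1 := congrArg (HahnSeries.ofPowerSeries ℤ ℝ) hred
    rw [map_reducedPolynomial, map_zero, HahnSeries.ofPowerSeries_C, HahnSeries.ofPowerSeries_C,
      HahnSeries.ofPowerSeries_X] at h1
    rw [formalResolvent, ← hmk, map_mul, HahnSeries.ofPowerSeries_X, resolventPolynomial_eq, h1]
    rw [formalZ, HahnSeries.single_mul_single]
    simp
  · refine ⟨16 * (1 + c) ^ 2, fun z hz => ?_⟩
    have hd0 : ∀ s, 0 ≤ d s := by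
      intro s; cases s <;> simp [hd, hc.le]
    have hdc : ∀ s, d s ≤ 1 + c := by
      intro s; cases s <;> simp [hd, hc.le]
    have hz0 : 0 < ‖z‖ := lt_of_le_of_lt (by positivity) hz
    have hgeo : Summable fun n : ℕ => (1 + c) * ‖z‖⁻¹ * (16 * (1 + c) ^ 2 * ‖z‖⁻¹) ^ n := by
      refine (summable_geometric_of_lt_one (by positivity) ?_).mul_left _
      rw [← div_eq_mul_inv, div_lt_one hz0]
      exact hz
    refine Summable.of_norm_bounded hgeo fun n => ?_
    have h1 := limitMoment_le_catalan hd0 (r := m) (by exact_mod_cast hm) hdc false (2 * n)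
    have h2 : (catalan (2 * n) : ℝ) ≤ 4 ^ (2 * n) := by exact_mod_cast catalan_le_four_pow (2 * n)
    have h3 : limitMoment d (m : ℝ) false (2 * n) / (m : ℝ) ^ (2 * n)
        ≤ (1 + c) * (16 * (1 + c) ^ 2) ^ n := by
      rw [div_le_iff₀ (by positivity)]
      refine h1.trans ((mul_le_mul_of_nonneg_left h2 (by positivity)).trans (le_of_eq ?_))
      rw [mul_pow (m : ℝ), pow_mul (1 + c), pow_mul (4 : ℝ), mul_pow]
      norm_num
      ring
    have h4 : 0 ≤ limitMoment d (m : ℝ) false (2 * n) / (m : ℝ) ^ (2 * n) :=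
      div_nonneg (limitMoment_nonneg hd0 hmR.le _ _) (by positivity)
    rw [resolventTerm, norm_mul, norm_pow, norm_inv, Complex.norm_real, Real.norm_of_nonneg h4]
    refine (mul_le_mul_of_nonneg_right h3 (by positivity)).trans (le_of_eq ?_)
    rw [mul_pow _ (‖z‖⁻¹), pow_succ]
    ring
  · intro z hz hsum
    have hz' : z⁻¹ ≠ 0 := inv_ne_zero hz
    have hterm : ∀ n, resolventTerm
        (fun n => limitMoment d (m : ℝ) false (2 * n) / (m : ℝ) ^ (2 * n)) z n
        = z⁻¹ * (((PowerSeries.coeff n (momentSeries d m false 0) : ℝ) : ℂ) * z⁻¹ ^ n) := by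
      intro n
      rw [hmk, PowerSeries.coeff_mk, resolventTerm, pow_succ]
      ring
    have hmem : momentSeries d m false 0 ∈ convergentSeries z⁻¹ := by
      have h1 := hsum.mul_left z
      refine h1.norm.congr fun n => ?_
      rw [hterm, mul_inv_cancel_left₀ hz]
    have h2 := reducedPolynomial_evalSeries hmem hred
    simp_rw [hterm]
    rw [tsum_mul_left, resolventPolynomial_eq _ _ _ _ _ (inv_mul_cancel₀ hz)]
    simpa using h2
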